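/- Let $d\ge 2$ and let $V$ denote volume in $\mathbb R^d$. There are constants $c>0$ and $\eta_0$, depending only on $d$, such that the following holds for every convex polytope $P\subset\mathbb R^d$ with $V(P)=1$ and every $\eta\ge\eta_0$. Notation. $F(P)$ is the number of flags of $P$, i.e. of sequences of faces $F_0\subset F_1\subset\dots\subset F_{d-1}$ of $P$ with $\dim F_i=i$. For $z\in P$ put $v(z)=\min\{V(P\cap H): H \text{ a closed half-space},\ z\in H\}$; for $t>0$ put $P(v\ge t)=\{z\in P: v(z)\ge t\}$, $P(v\le t)=\{z\in P:v(z)\le t\}$, $P(v=t)=\partial P(v\ge t)$. For a unit vector $u$, let $h_P(u)=\max_{x\in P}u\cdot x$; for a cap $C=P\cap\{x: u\cdot x\ge h_P(u)-t\}$ and $\lambda>0$ let $C^\lambda=P\cap\{x:u\cdot x\ge h_P(u)-\lambda t\}$. A minimal cap of $z\in P$ is a cap $C(z)\ni z$ with $V(C(z))=v(z)$. Let $M(z,\lambda)=z+\lambda[(P-z)\cap(z-P)]$. Put $$T=\frac{\alpha\ln\ln\eta}{\eta},\quad s=\frac1{\eta(\ln\eta)^{\beta}},\quad T^*=d6^dT,\quad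 \gamma=3d^36^d,\quad \alpha=(6d)^d(4d^2+d-1),\quad \beta=4d^2+d-1 .$$ Let $\{y_1,\dots,y_m\}$ ($y_j$ distinct) be any inclusion-maximal set of points of $P(v=T)$ whose regions $M(y_j,\frac12)$ are pairwise disjoint, let $C(y_j)$ be any choice of minimal caps, and put $K_j'=M(y_j,\frac12)\cap C(y_j)$, $K_j=C(y_j)^6$ (the economic cap covering of $P(v\le T)$), $K_j^\gamma=C(y_j)^{6\gamma}$. Let $S_1,\dots,S_m$ be any closed sets with pairwise disjoint interiors such that $\bigcup_jS_j=P$, $K_j'\subset S_j$ and $S_j\cap P(v\le T^*)\subset K_j^\gamma$ for all $j$, and put $S_j'=S_j\cap P(v\le T^*)$. Let $L_i$ be the union of all $S_k'$ for which there are points $a\in S_i'\cap P(v\ge s)$ and $b\in S_k'\cap P(v\ge s)$ such that the segment $[a,b]$ is disjoint from $P(v\ge T^*)$. Let $\mathcal G$ be the graph with vertex set $\{1,\dots,m\}$ in which distinct $i,j$ are joined by an edge if and only if there is a $k$ with $S_k'\subset L_i\cap L_j$. Then the maximal degree $D$ of $\mathcal G$ satisfies $$D< c\,F(P)^6(\ln\ln\eta)^{6(d-1)}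 .$$ -/

import Mathlib

open MeasureTheory

noncomputable section

namespace PoissonPolytope

/-- Euclidean space `ℝ^d`. -/
abbrev E (d : ℕ) := EuclideanSpace ℝ (Fin d)

variable {d : ℕ}

/-- A convex polytope: the convex hull of finitely many points. -/
def IsPolytope (P : Set (E d)) : Prop :=
  ∃ V : Finset (E d), P = convexHull ℝ (V : Set (E d))

/-- `F` is a (nonempty) face of `P` of dimension `i`. -/
def IsFaceOfDim (P F : Set (E d)) (i : ℕ) : Prop :=
  F.Nonempty ∧ IsExposed ℝ P F ∧ Module.finrank ℝ (vectorSpan ℝ F) = i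

/-- The set of flags `F₀ ⊆ F₁ ⊆ ⋯ ⊆ F_{d-1}` of `P`, where `F_i` is a face of dimension `i`. -/
def flags (P : Set (E d)) : Set (Fin d → Set (E d)) :=
  {F | (∀ i, IsFaceOfDim P (F i) i) ∧ Monotone F}

/-- The number `F(P)` of flags of `P` (a finite number when `P` is a polytope). -/
def numFlags (P : Set (E d)) : ℕ := (flags P).ncard

/-- The closed half-space `{x | u · x ≥ c}`. -/
def halfSpace (u : E d) (c : ℝ) : Set (E d) := {x | c ≤ inner ℝ u x}

/-- The support function `h_K(u) = max {u · x | x ∈ K}`. -/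
def supportFn (K : Set (E d)) (u : E d) : ℝ := sSup ((fun x => inner ℝ u x) '' K)

/-- The cap of `K` with unit outer normal `u` and depth `t`. If `C = cap K u t`, then the
enlarged (or shrunk) cap `C^l` is `cap K u (l * t)`. -/
def cap (K : Set (E d)) (u : E d) (t : ℝ) : Set (E d) := K ∩ halfSpace u (supportFn K u - t)

/-- `v(z) = min {V(K ∩ H) | H a closed half-space containing z}`. -/
def v (K : Set (E d)) (z : E d) : ℝ :=
  sInf {r | ∃ (u : E d) (c : ℝ), ‖u‖ = 1 ∧ z ∈ halfSpace u c ∧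
    r = volume.real (K ∩ halfSpace u c)}

/-- The floating body `K(v ≥ t)`. -/
def floatingBody (K : Set (E d)) (t : ℝ) : Set (E d) := {z | z ∈ K ∧ t ≤ v K z}

/-- The wet part `K(v ≤ t)`. -/
def wetPart (K : Set (E d)) (t : ℝ) : Set (E d) := {z | z ∈ K ∧ v K z ≤ t}

/-- `K(v = t)`, the boundary of the floating body `K(v ≥ t)`. -/
def levelSurface (K : Set (E d)) (t : ℝ) : Set (E d) := frontier (floatingBody K t)

/-- The Macbeath region `M(z, l) = z + l [(K - z) ∩ (z - K)]`. -/
def macbeath (K : Set (E d)) (z : E d) (l : ℝ) : Set (E d) :=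
  (fun w => z + l • w) '' {w | z + w ∈ K ∧ z - w ∈ K}

/-- `cap K u t` is a minimal cap of `z`: it contains `z` and has volume `v(z)`. -/
def IsMinimalCap (K : Set (E d)) (z u : E d) (t : ℝ) : Prop :=
  ‖u‖ = 1 ∧ z ∈ cap K u t ∧ volume.real (cap K u t) = v K z

/-- `Z` is saturated on `K(v = t)`: a (with respect to inclusion) maximal set of points of
`K(v = t)` with pairwise disjoint Macbeath regions of factor `1/2`. -/
def IsSaturated (K : Set (E d)) (t : ℝ) (Z : Set (E d)) : Prop :=
  Maximal (fun W : Set (E d) =>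
    W ⊆ levelSurface K t ∧ W.PairwiseDisjoint (fun z => macbeath K z (1 / 2))) Z

/-- A choice of the data of an economic cap covering of `K(v ≤ t)`: an enumeration
`y_1, …, y_m` of a saturated system on `K(v = t)` and a minimal cap `C(y_j)` of each point,
given by its unit normal and its depth. -/
structure CapSystem (K : Set (E d)) (t : ℝ) where
  m : ℕ
  point : Fin m → E d
  point_injective : Function.Injective point
  saturated : IsSaturated K t (Set.range point)
  normal : Fin m → E d
  depth : Fin m → ℝ
  minimal : ∀ j, IsMinimalCap K (point j) (normal j) (depth j)

namespace CapSystem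

variable {K : Set (E d)} {t : ℝ}

/-- The covering cap to the power `l`: `K_j^l = (C^6(y_j))^l = C^{6 l}(y_j)`. -/
def bigCap (Q : CapSystem K t) (l : ℝ) (j : Fin Q.m) : Set (E d) :=
  cap K (Q.normal j) (l * (6 * Q.depth j))

/-- The half Macbeath region `K'_j = M(y_j, 1/2) ∩ C(y_j)`. -/
def smallCap (Q : CapSystem K t) (j : Fin Q.m) : Set (E d) :=
  macbeath K (Q.point j) (1 / 2) ∩ cap K (Q.normal j) (Q.depth j)

end CapSystem

/-- `α = (6d)^d (4d² + d - 1)`. -/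
def alpha (d : ℕ) : ℝ := (6 * d) ^ d * (4 * d ^ 2 + d - 1)

/-- `β = 4d² + d - 1`. -/
def beta (d : ℕ) : ℝ := 4 * d ^ 2 + d - 1

/-- `γ = 3 d³ 6^d`. -/
def gam (d : ℕ) : ℝ := 3 * d ^ 3 * 6 ^ d

/-- `T = α ln ln η / η`. -/
def T (d : ℕ) (η : ℝ) : ℝ := alpha d * Real.log (Real.log η) / η

/-- `T* = d 6^d T`. -/
def Tstar (d : ℕ) (η : ℝ) : ℝ := d * 6 ^ d * T d η

/-- `s = 1 / (η (ln η)^β)`. -/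
def s (d : ℕ) (η : ℝ) : ℝ := 1 / (η * Real.log η ^ beta d)

/-- A choice of the sets `S_1, …, S_m`: closed sets with pairwise disjoint interiors and
union `P`, with `K'_j ⊆ S_j` and `S_j ∩ P(v ≤ T*) ⊆ K_j^γ`. -/
structure CellSystem (P : Set (E d)) (η : ℝ) (Q : CapSystem P (T d η)) where
  S : Fin Q.m → Set (E d)
  closed : ∀ j, IsClosed (S j)
  interior_disjoint : Pairwise fun i j => Disjoint (interior (S i)) (interior (S j))
  union : ⋃ j, S j = P
  smallCap_subset : ∀ j, Q.smallCap j ⊆ S j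
  subset_bigCap : ∀ j, S j ∩ wetPart P (Tstar d η) ⊆ Q.bigCap (gam d) j

namespace CellSystem

variable {P : Set (E d)} {η : ℝ} {Q : CapSystem P (T d η)}

/-- `S'_j = S_j ∩ P(v ≤ T*)`. -/
def S' (R : CellSystem P η Q) (j : Fin Q.m) : Set (E d) := R.S j ∩ wetPart P (Tstar d η)

/-- There are `a ∈ S'_i ∩ P(v ≥ s)` and `b ∈ S'_k ∩ P(v ≥ s)` such that the segment `[a, b]` is
disjoint from `P(v ≥ T*)`. -/
def Sees (R : CellSystem P η Q) (i k : Fin Q.m) : Prop :=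
  ∃ a ∈ R.S' i ∩ floatingBody P (s d η), ∃ b ∈ R.S' k ∩ floatingBody P (s d η),
    Disjoint (segment ℝ a b) (floatingBody P (Tstar d η))

/-- The visibility union `L_i`: the union of all `S'_k` seen from `S'_i`. -/
def L (R : CellSystem P η Q) (i : Fin Q.m) : Set (E d) := ⋃ k ∈ {k | R.Sees i k}, R.S' k

/-- The dependency graph: distinct `i`, `j` are adjacent iff some `S'_k` is contained in
`L_i ∩ L_j`. -/
def graph (R : CellSystem P η Q) : SimpleGraph (Fin Q.m) where
  Adj i j := i ≠ j ∧ ∃ k, R.S' k ⊆ R.L i ∩ R.L j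
  symm := ⟨fun _ _ h => ⟨h.1.symm, h.2.imp fun _ hk => hk.trans (Set.inter_comm _ _).subset⟩⟩
  loopless := ⟨fun _ h => h.1 rfl⟩

open Classical in
/-- The maximal degree `D` of the dependency graph. -/
def maxDeg (R : CellSystem P η Q) : ℕ := R.graph.maxDegree

end CellSystem

end PoissonPolytope

end

namespace PoissonPolytope

variable {d : ℕ} {K : Set (E d)}

/-! The proof is a packing argument. The sets `K'_j` are disjoint, have volume at least a constant
times `T`, and lie in `P(v ≤ 2^d T)`. If the `K'_j` of all neighbours `j` of `i` lie in one cap `D`,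
their number is `O(V(D ∩ P(v ≤ 2^d T)) / T)`. So `D` must not be too large, and a cap must contain
little of the wet part.

Finding `D`: if `S'_i` sees `S'_k`, separating the segment from `P(v ≥ T*)` yields a cap of volume
`O(T)` that meets both `K_i^γ` and `K_k^γ` at points with `v ≥ s`. Two caps of volume `O(T)` with
such a common point contain each other after enlargement by a factor `l = O(T/s)`
(`cap_subset_of_mem_inter`). This rests on `v(x)` being comparable to the volume of `M(x,1)`
(`v_le_volume_macbeath_one`) and on packing translates of a Macbeath region
(`subset_cap_of_macbeath_subset`). An edge `i`–`j` is a chain of four such links, so `D` can be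
`K_i^γ` enlarged by `l^4`. Its volume is `O(l^(4d) T)`, with `l` polylogarithmic in `η`.

The wet part: one simplex per flag covers `P` (`exists_simplex_cover`), and the half-space of `D`
cuts each into boundedly many simplices inside `D`. In an affine chart at a vertex, `v` dominates
the product of the coordinates up to constants, so the wet part lies under a hyperbolic surface `∏
x_k ≤ ε`, which cuts off volume `O(ε log^d(1/ε))`. The logarithm is that of `V(D)/T`, hence `O(ln ln
η)` (`volume_cap_inter_wetPart_le`).

The degree is thus `O(F(P) (ln ln η)^d)`, which is stronger than required. -/

/-! ### Elementary properties of Macbeath regions, caps and `v`. -/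

theorem mem_macbeath_one {z y : E d} :
    y ∈ macbeath K z 1 ↔ y ∈ K ∧ (2 : ℝ) • z - y ∈ K := by
  constructor
  · rintro ⟨w, ⟨h1, h2⟩, rfl⟩
    refine ⟨by simpa using h1, ?_⟩
    convert h2 using 1
    simp only
    module
  · rintro ⟨h1, h2⟩
    refine ⟨y - z, ⟨by simpa using h1, ?_⟩, by simp⟩
    convert h2 using 1
    module

theorem macbeath_eq_homothety (z : E d) (l : ℝ) :
    macbeath K z l = AffineMap.homothety z l '' macbeath K z 1 := by
  ext y
  constructor
  · rintro ⟨w, hw, rfl⟩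
    exact ⟨z + w, ⟨w, hw, by simp⟩, by simp [AffineMap.homothety_apply, add_comm]⟩
  · rintro ⟨_, ⟨w, hw, rfl⟩, rfl⟩
    exact ⟨w, hw, by simp [AffineMap.homothety_apply, add_comm]⟩

theorem macbeath_one_eq (z : E d) :
    macbeath K z 1 = K ∩ (fun y => (2 : ℝ) • z - y) ⁻¹' K := by
  ext y; exact mem_macbeath_one

theorem macbeath_one_subset (z : E d) : macbeath K z 1 ⊆ K := fun _ h => (mem_macbeath_one.1 h).1

theorem isCompact_macbeath_one (hK : IsCompact K) (z : E d) : IsCompact (macbeath K z 1) := by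
  rw [macbeath_one_eq]
  exact hK.inter_right (hK.isClosed.preimage (by fun_prop))

theorem convex_macbeath_one (hc : Convex ℝ K) (z : E d) : Convex ℝ (macbeath K z 1) := by
  intro a ha b hb p q hp hq hpq
  rw [mem_macbeath_one] at *
  refine ⟨hc ha.1 hb.1 hp hq hpq, ?_⟩
  convert hc ha.2 hb.2 hp hq hpq using 1
  obtain rfl : q = 1 - p := by linarith
  module

theorem isCompact_macbeath (hK : IsCompact K) (z : E d) (l : ℝ) : IsCompact (macbeath K z l) := by
  rw [macbeath_eq_homothety]
  exact (isCompact_macbeath_one hK z).image (AffineMap.homothety_continuous z l)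

theorem convex_macbeath (hc : Convex ℝ K) (z : E d) (l : ℝ) : Convex ℝ (macbeath K z l) := by
  rw [macbeath_eq_homothety]
  exact (convex_macbeath_one hc z).affine_image _

theorem macbeath_one_mono {A B : Set (E d)} (h : A ⊆ B) (z : E d) :
    macbeath A z 1 ⊆ macbeath B z 1 := fun _ hy => by
  rw [mem_macbeath_one] at *
  exact ⟨h hy.1, h hy.2⟩

theorem reflect_mem_macbeath {z y : E d} {l : ℝ} (h : y ∈ macbeath K z l) :
    (2 : ℝ) • z - y ∈ macbeath K z l := by
  obtain ⟨w, ⟨h1, h2⟩, rfl⟩ := h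
  refine ⟨-w, ⟨by simpa [sub_eq_add_neg] using h2, by simpa using h1⟩, ?_⟩
  simp only
  module

theorem center_mem_of_mem_macbeath_one (hc : Convex ℝ K) {z y : E d} (h : y ∈ macbeath K z 1) :
    z ∈ K := by
  rw [mem_macbeath_one] at h
  convert hc h.1 h.2 (show (0 : ℝ) ≤ 1 / 2 by norm_num) (show (0 : ℝ) ≤ 1 / 2 by norm_num)
    (by norm_num) using 1
  module

theorem macbeath_subset (hc : Convex ℝ K) (z : E d) {l : ℝ} (h0 : 0 ≤ l) (h1 : l ≤ 1) :
    macbeath K z l ⊆ K := by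
  rintro _ ⟨w, hw, rfl⟩
  have hz : z ∈ K := by
    refine center_mem_of_mem_macbeath_one hc (y := z + w) ?_
    exact ⟨w, hw, by simp⟩
  convert hc hz hw.1 (sub_nonneg.2 h1) h0 (by ring) using 1
  simp only
  module

theorem volume_macbeath (z : E d) {l : ℝ} (h0 : 0 ≤ l) :
    volume.real (macbeath K z l) = l ^ d * volume.real (macbeath K z 1) := by
  rw [macbeath_eq_homothety, Measure.real, Measure.addHaar_image_homothety]
  simp [Measure.real, ENNReal.toReal_mul, abs_of_nonneg h0, pow_nonneg h0]

theorem mem_halfSpace {u x : E d} {c : ℝ} : x ∈ halfSpace u c ↔ c ≤ inner ℝ u x := Iff.rfl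

theorem isClosed_halfSpace (u : E d) (c : ℝ) : IsClosed (halfSpace u c) :=
  isClosed_le continuous_const (by fun_prop)

theorem convex_halfSpace (u : E d) (c : ℝ) : Convex ℝ (halfSpace u c) :=
  convex_halfSpace_ge (𝕜 := ℝ) (f := fun x : E d => inner ℝ u x)
    ⟨fun x y => inner_add_right _ _ _, fun a x => by simp [inner_smul_right]⟩ c

theorem isCompact_inter_halfSpace (hK : IsCompact K) (u : E d) (c : ℝ) :
    IsCompact (K ∩ halfSpace u c) := hK.inter_right (isClosed_halfSpace u c)

theorem isCompact_cap (hK : IsCompact K) (u : E d) (t : ℝ) : IsCompact (cap K u t) :=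
  isCompact_inter_halfSpace hK _ _

theorem convex_cap (hc : Convex ℝ K) (u : E d) (t : ℝ) : Convex ℝ (cap K u t) :=
  hc.inter (convex_halfSpace _ _)

theorem volume_real_mono {A B : Set (E d)} (hB : IsCompact B) (h : A ⊆ B) :
    volume.real A ≤ volume.real B :=
  measureReal_mono h hB.measure_lt_top.ne

theorem inner_le_supportFn (hK : IsCompact K) (u : E d) {x : E d} (hx : x ∈ K) :
    inner ℝ u x ≤ supportFn K u :=
  le_csSup (hK.image (by fun_prop)).bddAbove ⟨x, hx, rfl⟩

theorem exists_inner_eq_supportFn (hK : IsCompact K) (hne : K.Nonempty) (u : E d) :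
    ∃ x ∈ K, inner ℝ u x = supportFn K u := by
  obtain ⟨x, hx, h⟩ := (hK.image (f := fun x : E d => inner ℝ u x) (by fun_prop)).sSup_mem
    (hne.image _)
  exact ⟨x, hx, h⟩

theorem mem_cap {u x : E d} {t : ℝ} : x ∈ cap K u t ↔ x ∈ K ∧ supportFn K u - t ≤ inner ℝ u x :=
  Iff.rfl

theorem cap_mono (u : E d) {t t' : ℝ} (h : t ≤ t') : cap K u t ⊆ cap K u t' :=
  fun _ hx => ⟨hx.1, le_trans (sub_le_sub_left h _) hx.2⟩

theorem depth_nonneg (hK : IsCompact K) {u x : E d} {t : ℝ} (h : x ∈ cap K u t) : 0 ≤ t := by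
  have := inner_le_supportFn hK u h.1
  have := (mem_cap.1 h).2
  linarith

/-- Contracting towards a contact point `x` of the supporting hyperplane keeps a point in `K` and
divides its depth by `l`. -/
theorem cap_mul_subset_homothety (hc : Convex ℝ K) {u x : E d} {t l : ℝ}
    (hl : 1 ≤ l) (hx : x ∈ K) (hxu : inner ℝ u x = supportFn K u) :
    cap K u (l * t) ⊆ AffineMap.homothety x l '' cap K u t := by
  intro z hz
  rw [mem_cap] at hz
  have hl0 : 0 < l := by linarith
  refine ⟨x + l⁻¹ • (z - x), ⟨?_, ?_⟩, ?_⟩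
  · convert hc hx hz.1 (sub_nonneg.2 (inv_le_one_of_one_le₀ hl)) (inv_nonneg.2 hl0.le)
      (by ring) using 1
    module
  · rw [mem_halfSpace]
    rw [inner_add_right, inner_smul_right, inner_sub_right, hxu]
    have : l⁻¹ * (supportFn K u - inner ℝ u z) ≤ l⁻¹ * (l * t) := by
      gcongr
      linarith [hz.2]
    rw [inv_mul_cancel_left₀ hl0.ne'] at this
    linarith
  · simp [AffineMap.homothety_apply, smul_smul, hl0.ne']

theorem volume_cap_mul_le (hK : IsCompact K) (hc : Convex ℝ K) (u : E d) {t l : ℝ}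
    (hl : 1 ≤ l) : volume.real (cap K u (l * t)) ≤ l ^ d * volume.real (cap K u t) := by
  rcases K.eq_empty_or_nonempty with rfl | hne
  · simp [cap]
  obtain ⟨x, hx, hxu⟩ := exists_inner_eq_supportFn hK hne u
  refine (volume_real_mono ((isCompact_cap hK u t).image
    (AffineMap.homothety_continuous x l)) (cap_mul_subset_homothety hc hl hx hxu)).trans ?_
  rw [Measure.real, Measure.addHaar_image_homothety]
  have hl0 : 0 ≤ l := zero_le_one.trans hl
  simp [Measure.real, ENNReal.toReal_mul, abs_of_nonneg hl0, pow_nonneg hl0]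

/-- A point of the enlarged cap is `x + m(y - x)`, with `x` extremal for `w` and `y` in the small
cap. Its depth for `u` is `m` times that of `y` minus `m - 1` times that of `x`, and the latter is
nonnegative. -/
theorem cap_mul_subset_of_cap_subset (hK : IsCompact K) (hc : Convex ℝ K) {u w : E d}
    {t r l m : ℝ} (hr : 0 ≤ r) (hm : 1 ≤ m) (h : cap K w r ⊆ cap K u (l * t)) :
    cap K w (m * r) ⊆ cap K u ((m * l) * t) := by
  rcases K.eq_empty_or_nonempty with rfl | hne
  · simp [cap]
  obtain ⟨x, hx, hxw⟩ := exists_inner_eq_supportFn hK hne w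
  intro z hz
  obtain ⟨y, hy, rfl⟩ := cap_mul_subset_homothety hc hm hx hxw hz
  refine ⟨hz.1, ?_⟩
  have h1 := (mem_cap.1 (h hy)).2
  have h2 := inner_le_supportFn hK u hx
  have h3 := (mem_cap.1 (h ⟨hx, by rw [mem_halfSpace, hxw]; linarith⟩)).2
  rw [mem_halfSpace]
  simp only [AffineMap.homothety_apply, vsub_eq_sub, vadd_eq_add, inner_add_right,
    inner_smul_right, inner_sub_right]
  nlinarith

theorem macbeath_one_subset_cap (hK : IsCompact K) {u x : E d} {t : ℝ} (hx : x ∈ cap K u t) :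
    macbeath K x 1 ⊆ cap K u (2 * t) := by
  intro y hy
  rw [mem_macbeath_one] at hy
  refine ⟨hy.1, ?_⟩
  have h1 := inner_le_supportFn hK u hy.2
  have h2 := (mem_cap.1 hx).2
  rw [mem_halfSpace]
  rw [inner_sub_right, inner_smul_right] at h1
  linarith

theorem inter_halfSpace_eq_cap (u : E d) (c : ℝ) :
    K ∩ halfSpace u c = cap K u (supportFn K u - c) := by
  simp [cap]

theorem halfSpace_smul (u : E d) (c : ℝ) {r : ℝ} (hr : 0 < r) :
    halfSpace (r • u) (r * c) = halfSpace u c := by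
  ext x
  simp [halfSpace, inner_smul_left, hr]

/-- The normal is not required to be a unit vector because separation theorems supply it
unnormalised. -/
theorem v_le {z u : E d} {c : ℝ} (hu : u ≠ 0) (hz : z ∈ halfSpace u c) :
    v K z ≤ volume.real (K ∩ halfSpace u c) := by
  have hn : 0 < ‖u‖⁻¹ := inv_pos.2 (norm_pos_iff.2 hu)
  rw [← halfSpace_smul u c hn] at hz ⊢
  refine csInf_le ⟨0, ?_⟩ ⟨_, _, ?_, hz, rfl⟩
  · rintro _ ⟨_, _, _, _, rfl⟩
    exact measureReal_nonneg
  · rw [norm_smul, norm_inv, norm_norm, inv_mul_cancel₀ (norm_ne_zero_iff.2 hu)]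

theorem exists_unit (hd : 0 < d) : ∃ u : E d, ‖u‖ = 1 :=
  ⟨EuclideanSpace.single ⟨0, hd⟩ 1, by simp⟩

theorem le_v (hd : 0 < d) {z : E d} {r : ℝ}
    (h : ∀ (u : E d) (c : ℝ), ‖u‖ = 1 → z ∈ halfSpace u c → r ≤ volume.real (K ∩ halfSpace u c)) :
    r ≤ v K z := by
  obtain ⟨u, hu⟩ := exists_unit hd
  refine le_csInf ⟨_, u, inner ℝ u z, hu, mem_halfSpace.2 le_rfl, rfl⟩ ?_
  rintro _ ⟨u, c, hu, hz, rfl⟩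
  exact h u c hu hz

theorem exists_halfSpace_of_v_lt (hd : 0 < d) {z : E d} {r : ℝ} (h : v K z < r) :
    ∃ (u : E d) (c : ℝ), ‖u‖ = 1 ∧ z ∈ halfSpace u c ∧ volume.real (K ∩ halfSpace u c) < r := by
  by_contra! hcon
  exact absurd (le_v hd hcon) (not_le.2 h)

/-! ### Comparing `v` with volumes of Macbeath regions. -/

/-- The region is symmetric about `z`, and reflection in `z` carries its part outside the half-space
into the half-space. -/
theorem volume_macbeath_inter_halfSpace (hK : IsCompact K) {z u : E d} {c l : ℝ}
    (hz : z ∈ halfSpace u c) :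
    volume.real (macbeath K z l) ≤ 2 * volume.real (macbeath K z l ∩ halfSpace u c) := by
  have hcpt := isCompact_inter_halfSpace (isCompact_macbeath hK z l) u c
  have hsub : macbeath K z l ⊆ (macbeath K z l ∩ halfSpace u c) ∪
      AffineMap.homothety z (-1 : ℝ) '' (macbeath K z l ∩ halfSpace u c) := by
    intro y hy
    by_cases h : y ∈ halfSpace u c
    · exact Or.inl ⟨hy, h⟩
    · refine Or.inr ⟨(2 : ℝ) • z - y, ⟨reflect_mem_macbeath hy, ?_⟩, ?_⟩
      · rw [mem_halfSpace] at *
        rw [not_le] at h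
        rw [inner_sub_right, inner_smul_right]
        linarith
      · simp only [AffineMap.homothety_apply, vsub_eq_sub, vadd_eq_add]
        module
  refine (volume_real_mono (hcpt.union (hcpt.image (AffineMap.homothety_continuous z _)))
    hsub).trans ?_
  refine (measureReal_union_le _ _).trans ?_
  rw [two_mul]
  refine add_le_add le_rfl (le_of_eq ?_)
  simp [Measure.real, Measure.addHaar_image_homothety]

theorem volume_macbeath_one_le (hd : 0 < d) (hK : IsCompact K) (z : E d) :
    volume.real (macbeath K z 1) ≤ 2 * v K z := by
  have : volume.real (macbeath K z 1) / 2 ≤ v K z := by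
    refine le_v hd fun u c _ hz => ?_
    have h1 := volume_macbeath_inter_halfSpace (l := 1) hK hz
    have h2 := volume_real_mono (isCompact_inter_halfSpace hK u c)
      (Set.inter_subset_inter_left (halfSpace u c) (macbeath_one_subset (K := K) z))
    linarith
  linarith

/-- Since `M(y,1) = A ∩ (2y - A)`, this is Fubini: for fixed `z` the set of `y` with `2y - z ∈ A`
has volume `2^(-d) V(A)`. -/
theorem lintegral_volume_macbeath {A : Set (E d)} (hA : IsCompact A) :
    ∫⁻ y, volume (macbeath A y 1) = (2 : ENNReal)⁻¹ ^ d * volume A ^ 2 := by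
  have hm : MeasurableSet A := hA.measurableSet
  have h1 : ∀ y, volume (macbeath A y 1) =
      ∫⁻ z, A.indicator 1 z * A.indicator (1 : E d → ENNReal) ((2 : ℝ) • y - z) := by
    intro y
    rw [macbeath_one_eq, ← lintegral_indicator_one
      (hm.inter (hm.preimage (by fun_prop)))]
    refine lintegral_congr fun z => ?_
    by_cases hz : z ∈ A <;> by_cases hz' : (2 : ℝ) • y - z ∈ A <;>
      simp [Set.indicator, hz, hz']
  have hf : Measurable (A.indicator (1 : E d → ENNReal)) := measurable_one.indicator hm
  have h2 : ∀ z : E d, ∫⁻ y, A.indicator (1 : E d → ENNReal) ((2 : ℝ) • y - z) =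
      (2 : ENNReal)⁻¹ ^ d * volume A := by
    intro z
    have : ∀ y : E d, A.indicator (1 : E d → ENNReal) ((2 : ℝ) • y - z) =
        ((fun y : E d => (2 : ℝ) • y) ⁻¹' ((fun y => y - z) ⁻¹' A)).indicator 1 y := fun _ => rfl
    simp_rw [this]
    rw [lintegral_indicator_one ((hm.preimage (by fun_prop)).preimage (by fun_prop)),
      Measure.addHaar_preimage_smul _ two_ne_zero]
    simp only [sub_eq_add_neg, measure_preimage_add_right]
    congr 1
    simp [abs_of_pos, ENNReal.ofReal_inv_of_pos, ENNReal.ofReal_pow, ENNReal.inv_pow]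
  simp_rw [h1]
  rw [lintegral_lintegral_swap (by fun_prop)]
  have h3 : ∀ z : E d, ∫⁻ y, A.indicator 1 z * A.indicator (1 : E d → ENNReal) ((2 : ℝ) • y - z) =
      A.indicator 1 z * ((2 : ENNReal)⁻¹ ^ d * volume A) := fun z => by
    rw [lintegral_const_mul _ (by fun_prop), h2]
  simp_rw [h3]
  rw [lintegral_mul_const _ hf, lintegral_indicator_one hm]
  ring

/-- Macbeath regions in `A` have average volume `2^(-d) V(A)`, so a uniform bound on them bounds
`V(A)`. Null sets are ignored because the separation used later is not strict. -/
theorem volume_le_of_volume_macbeath_le {A : Set (E d)} (hA : IsCompact A) (hc : Convex ℝ A)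
    {r : ENNReal} (h : ∀ᵐ y : E d, y ∈ A → volume (macbeath A y 1) ≤ r) :
    volume A ≤ 2 ^ d * r := by
  have h1 : ∫⁻ y, volume (macbeath A y 1) ≤ ∫⁻ y, A.indicator (fun _ => r) y := by
    refine lintegral_mono_ae ?_
    filter_upwards [h] with y hy
    by_cases hyA : y ∈ A
    · simpa [hyA] using hy hyA
    · have : macbeath A y 1 = ∅ := by
        refine Set.eq_empty_of_forall_notMem fun w hw => ?_
        exact hyA (center_mem_of_mem_macbeath_one hc hw)
      simp [this]
  rw [lintegral_volume_macbeath hA, lintegral_indicator hA.measurableSet, setLIntegral_const] at h1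
  rcases eq_or_ne (volume A) 0 with h0 | h0
  · simp [h0]
  have htop : volume A ≠ ⊤ := hA.measure_lt_top.ne
  have h2 : (2 : ENNReal)⁻¹ ^ d * volume A ≤ r := by
    rw [sq, ← mul_assoc] at h1
    exact (ENNReal.mul_le_mul_iff_left h0 htop).1 h1
  calc volume A = 2 ^ d * ((2 : ENNReal)⁻¹ ^ d * volume A) := by
        rw [← mul_assoc, ← mul_pow, ENNReal.mul_inv_cancel (by norm_num) (by norm_num)]; simp
    _ ≤ 2 ^ d * r := by gcongr

theorem volume_hyperplane {u : E d} (hu : u ≠ 0) (c : ℝ) :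
    volume {y : E d | inner ℝ u y = c} = 0 := by
  rcases Set.eq_empty_or_nonempty {y : E d | inner ℝ u y = c} with h | ⟨x, hx⟩
  · rw [h, measure_empty]
  have hS : {y : E d | inner ℝ u y = c} =
      (AffineSubspace.mk' x (LinearMap.ker (innerₛₗ ℝ u)) : Set (E d)) := by
    ext y
    have hx' : inner ℝ u x = c := hx
    change inner ℝ u y = c ↔ y ∈ AffineSubspace.mk' x _
    simp [AffineSubspace.mem_mk', inner_sub_right, hx', sub_eq_zero]
  rw [hS]
  refine Measure.addHaar_affineSubspace _ _ fun htop => ?_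
  have : x + u ∈ AffineSubspace.mk' x (LinearMap.ker (innerₛₗ ℝ u)) := by
    rw [htop]; trivial
  simp [AffineSubspace.mem_mk', hu] at this

/-- Moving only `z i` inside its own Macbeath region moves the convex combination by `w i` times as
much and keeps it in `K`. So a translate of `M(z_i, w_i)` lies in the Macbeath region of the
combination. -/
theorem weighted_volume_macbeath_le (hK : IsCompact K) (hc : Convex ℝ K) {ι : Type*} [Fintype ι]
    {z : ι → E d} {w : ι → ℝ} (hz : ∀ i, z i ∈ K) (hw : ∀ i, 0 < w i) (hw1 : ∑ i, w i = 1)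
    (i : ι) : w i ^ d * volume.real (macbeath K (z i) 1) ≤
      volume.real (macbeath K (∑ i, w i • z i) 1) := by
  classical
  set x := ∑ i, w i • z i with hx
  have hsum : ∀ y : E d, ∑ j, w j • Function.update z i y j = x + w i • (y - z i) := by
    intro y
    have h1 : ∀ j, w j • Function.update z i y j =
        w j • z j + if j = i then w i • (y - z i) else 0 := by
      intro j
      by_cases hj : j = i
      · subst hj; simp [smul_sub]
      · simp [hj]
    simp [h1, Finset.sum_add_distrib, hx]
  have hmem : ∀ y ∈ K, x + w i • (y - z i) ∈ K := by
    intro y hy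
    rw [← hsum]
    refine hc.sum_mem (fun j _ => (hw j).le) hw1 fun j _ => ?_
    by_cases hj : j = i
    · subst hj; simpa using hy
    · simpa [hj] using hz j
  have hsub : macbeath K (z i) (w i) ⊆ (fun y => y + (x - z i)) ⁻¹' macbeath K x 1 := by
    rintro _ ⟨y, hy, rfl⟩
    rw [Set.mem_preimage, mem_macbeath_one]
    constructor
    · convert hmem _ hy.1 using 1
      module
    · convert hmem _ hy.2 using 1
      simp only
      module
  rw [← volume_macbeath _ (hw i).le]
  have hfin : volume ((fun y => y + (x - z i)) ⁻¹' macbeath K x 1) ≠ ⊤ := by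
    rw [measure_preimage_add_right]
    exact (isCompact_macbeath_one hK x).measure_lt_top.ne
  refine (measureReal_mono hsub hfin).trans ?_
  rw [Measure.real, measure_preimage_add_right, Measure.real]

/-- By Carathéodory, `x` would be a combination of at most `d + 1` such points, one of them with
weight at least `1/(d+1)`. Then `weighted_volume_macbeath_le` makes the region at `x` too large. -/
theorem notMem_convexHull_volume_macbeath_lt (hK : IsCompact K) (hc : Convex ℝ K) (x : E d) :
    x ∉ convexHull ℝ {y : E d |
      ((d : ℝ) + 1) ^ d * volume.real (macbeath K x 1) < volume.real (macbeath K y 1)} := by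
  intro hx
  obtain ⟨ι, _, z, w, hzs, hind, hw, hw1, hwx⟩ := eq_pos_convex_span_of_mem_convexHull hx
  have hz : ∀ i, z i ∈ K := by
    intro i
    have h1 := Set.mem_ofPred.1 (hzs ⟨i, rfl⟩)
    have h2 : 0 < volume.real (macbeath K (z i) 1) := lt_of_le_of_lt (by positivity) h1
    rcases Set.eq_empty_or_nonempty (macbeath K (z i) 1) with h | ⟨y, hy⟩
    · simp [h] at h2
    · exact center_mem_of_mem_macbeath_one hc hy
  have hne : (Finset.univ : Finset ι).Nonempty := by
    rw [Finset.nonempty_iff_ne_empty]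
    rintro h
    simp [h] at hw1
  have hcard : (Fintype.card ι : ℝ) ≤ d + 1 := by
    have h1 := hind.card_le_finrank_succ
    have h2 := Submodule.finrank_le (vectorSpan ℝ (Set.range z))
    rw [finrank_euclideanSpace_fin] at h2
    exact_mod_cast h1.trans (Nat.succ_le_succ h2)
  have hcard0 : 0 < Fintype.card ι := Finset.card_pos.2 hne
  obtain ⟨i, -, hi⟩ : ∃ i ∈ (Finset.univ : Finset ι), (Fintype.card ι : ℝ)⁻¹ ≤ w i := by
    refine Finset.exists_le_of_sum_le hne ?_
    rw [hw1, Finset.sum_const, Finset.card_univ, nsmul_eq_mul, mul_inv_cancel₀]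
    exact_mod_cast hcard0.ne'
  have hwi : ((d : ℝ) + 1)⁻¹ ≤ w i :=
    (inv_anti₀ (by exact_mod_cast hcard0) hcard).trans hi
  have h1 := weighted_volume_macbeath_le hK hc hz hw hw1 i
  rw [hwx] at h1
  have h2 := Set.mem_ofPred.1 (hzs ⟨i, rfl⟩)
  have h3 : 1 ≤ ((d : ℝ) + 1) ^ d * w i ^ d := by
    rw [← mul_pow]
    refine one_le_pow₀ ?_
    rw [inv_le_iff_one_le_mul₀' (by positivity)] at hwi
    exact hwi
  have h4 : ((d : ℝ) + 1) ^ d * (w i ^ d * volume.real (macbeath K (z i) 1)) ≤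
      ((d : ℝ) + 1) ^ d * volume.real (macbeath K x 1) := by gcongr
  have h5 : volume.real (macbeath K (z i) 1) ≤
      (((d : ℝ) + 1) ^ d * w i ^ d) * volume.real (macbeath K (z i) 1) :=
    le_mul_of_one_le_left measureReal_nonneg h3
  linarith

/-- If the hull has interior points, weak Hahn–Banach separation fails only on a hyperplane, which
is null. Otherwise the hull itself is null and any direction works. -/
theorem exists_weak_separation (hd : 0 < d) {B : Set (E d)} {x : E d} (hx : x ∉ convexHull ℝ B) :
    ∃ u : E d, u ≠ 0 ∧ ∀ᵐ y : E d, y ∈ halfSpace u (inner ℝ u x) → y ∉ B := by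
  have hconv := convex_convexHull ℝ B
  rcases Set.eq_empty_or_nonempty (interior (convexHull ℝ B)) with h | h
  · obtain ⟨u, hu⟩ := exists_unit hd
    refine ⟨u, fun h0 => by simp [h0] at hu, ?_⟩
    have h0 : volume (convexHull ℝ B) = 0 := by
      refine measure_mono_null (fun y hy => ?_) (hconv.addHaar_frontier volume)
      rw [frontier, h]
      exact ⟨subset_closure hy, id⟩
    have h1 : volume B = 0 := measure_mono_null (subset_convexHull ℝ B) h0
    filter_upwards [measure_eq_zero_iff_ae_notMem.1 h1] with y hy _ using hy
  · obtain ⟨f, hf, hfx⟩ := geometric_hahn_banach_of_nonempty_interior_point hconv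
      (fun h' => hx (interior_subset h')) h
    set u := (InnerProductSpace.toDual ℝ (E d)).symm f with hu
    have hfu : ∀ y, inner ℝ u y = f y := fun y => InnerProductSpace.toDual_symm_apply
    have hu0 : u ≠ 0 := by simpa [hu] using hf
    refine ⟨u, hu0, ?_⟩
    filter_upwards [measure_eq_zero_iff_ae_notMem.1 (volume_hyperplane hu0 (inner ℝ u x))]
      with y hy hyH hyB
    have h1 := hfx y (subset_convexHull ℝ B hyB)
    rw [mem_halfSpace] at hyH
    refine hy ?_
    rw [hfu, hfu] at *
    linarith

/-- The volume cut off by a minimal cap is at most a constant times the volume of the Macbeath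
region. -/
theorem v_le_volume_macbeath_one (hd : 0 < d) (hK : IsCompact K) (hc : Convex ℝ K) (x : E d) :
    v K x ≤ (2 * (d + 1)) ^ d * volume.real (macbeath K x 1) := by
  obtain ⟨u, hu, h⟩ := exists_weak_separation hd (notMem_convexHull_volume_macbeath_lt hK hc x)
  refine (v_le hu (mem_halfSpace.2 (le_refl (inner ℝ u x)))).trans ?_
  set A := K ∩ halfSpace u (inner ℝ u x) with hA
  have hAc : IsCompact A := isCompact_inter_halfSpace hK _ _
  set r : ℝ := ((d : ℝ) + 1) ^ d * volume.real (macbeath K x 1) with hr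
  have hr0 : 0 ≤ r := by positivity
  have h1 : volume A ≤ 2 ^ d * ENNReal.ofReal r := by
    refine volume_le_of_volume_macbeath_le hAc (hc.inter (convex_halfSpace _ _)) ?_
    filter_upwards [h] with y hy hyA
    have h2 : volume.real (macbeath K y 1) ≤ r := not_lt.1 (hy hyA.2)
    refine (measure_mono (macbeath_one_mono Set.inter_subset_left y)).trans ?_
    rw [← ENNReal.ofReal_toReal (isCompact_macbeath_one hK y).measure_lt_top.ne]
    exact ENNReal.ofReal_le_ofReal h2
  have h3 := ENNReal.toReal_mono (by finiteness) h1
  rw [ENNReal.toReal_mul, ENNReal.toReal_ofReal hr0] at h3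
  rw [mul_pow, mul_assoc, ← hr]
  simpa [Measure.real] using h3

/-! ### Containment of a convex set in an enlarged cap, by packing. -/

/-- Translate `M(x,1/2)` from `x` towards a deep point `z`, each step lowering `u` by `2t`. The
copies have `u`-width at most `t`, so they are disjoint. About `W/(4t)` of them fit in `D`, so
comparing volumes bounds the drop `W`. -/
theorem subset_cap_of_macbeath_subset (hK : IsCompact K) {u x : E d} {t : ℝ} (hu : u ≠ 0)
    (hx : x ∈ cap K u t) {D : Set (E d)} (hD : IsCompact D) (hDc : Convex ℝ D) (hDK : D ⊆ K)
    (hM : macbeath K x 1 ⊆ D) {A B : ℝ} (hA : volume.real D ≤ A) (hB0 : 0 < B)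
    (hB : B ≤ volume.real (macbeath K x 1)) :
    D ⊆ cap K u ((1 + 2 ^ (d + 2) * (A / B)) * t) := by
  intro z hz
  have hA0 : 0 ≤ A := measureReal_nonneg.trans hA
  have ht := depth_nonneg hK hx
  have hxu := (mem_cap.1 hx).2
  refine ⟨hDK hz, ?_⟩
  rw [mem_halfSpace]
  have ht0 : 0 < t := by
    -- A cap of depth zero would confine `M(x,1)` to a hyperplane, contradicting `B > 0`.
    refine ht.lt_of_ne' ?_
    rintro rfl
    have h1 : macbeath K x 1 ⊆ {y | inner ℝ u y = supportFn K u} := by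
      intro y hy
      have h2 := macbeath_one_subset_cap hK hx hy
      rw [mem_cap] at h2
      have := inner_le_supportFn hK u h2.1
      change inner ℝ u y = supportFn K u
      linarith [h2.2]
    have h3 := measure_mono_null h1 (volume_hyperplane hu _)
    rw [Measure.real, h3] at hB
    simp at hB
    linarith
  set W := inner ℝ u x - inner ℝ u z with hW
  suffices h : W ≤ 2 ^ (d + 2) * (A / B) * t by linarith
  rcases le_or_gt W 0 with hW0 | hW0
  · exact hW0.trans (by positivity)
  have hxD : x ∈ D := hM (mem_macbeath_one.2 ⟨hx.1, by convert hx.1 using 1; module⟩)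
  -- A point of the `k`-th copy is the midpoint of a point of `M(x,1)` and the point at parameter
  -- `4kt/W` on the segment from `x` to `z`. The latter requires `k ≤ W/(4t)`.
  set N := ⌊W / (4 * t)⌋₊ + 1 with hN
  set f : ℕ → E d := fun k => (2 * k * t / W) • (z - x) with hf
  set S : ℕ → Set (E d) := fun k => (fun y => y + (-f k)) ⁻¹' macbeath K x (1 / 2) with hS
  have hSD : ∀ k ∈ Finset.range N, S k ⊆ D := by
    intro k hk y hy
    obtain ⟨w, hw, hwy⟩ := hy
    have hk' : (k : ℝ) ≤ W / (4 * t) :=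
      (Nat.le_floor_iff (by positivity)).1 (Nat.lt_succ_iff.1 (Finset.mem_range.1 hk))
    have hτ : 2 * (2 * k * t / W) ≤ 1 := by
      rw [le_div_iff₀ (by positivity)] at hk'
      rw [← mul_div_assoc, div_le_one hW0]
      linarith
    have h1 : x + w ∈ D := hM ⟨w, hw, by simp⟩
    have h2 := hDc hz hxD (show 0 ≤ 2 * (2 * k * t / W) by positivity) (sub_nonneg.2 hτ) (by ring)
    convert hDc h1 h2 (show (0 : ℝ) ≤ 1 / 2 by norm_num) (show (0 : ℝ) ≤ 1 / 2 by norm_num)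
      (by norm_num) using 1
    have hy : y = x + (1 / 2 : ℝ) • w + f k := by
      simp only at hwy
      rw [hwy]; simp
    rw [hy, hf]
    module
  have hbound : ∀ k, ∀ y ∈ S k, |inner ℝ u y - inner ℝ u x + 2 * k * t| ≤ t / 2 := by
    intro k y hy
    obtain ⟨w, hw, hwy⟩ := hy
    have hy : y = x + (1 / 2 : ℝ) • w + f k := by
      simp only at hwy
      rw [hwy]; simp
    have h1 := inner_le_supportFn hK u hw.1
    have h2 := inner_le_supportFn hK u hw.2
    rw [inner_add_right] at h1
    rw [inner_sub_right] at h2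
    have h3 : inner ℝ u (f k) = - (2 * k * t) := by
      rw [hf, inner_smul_right, inner_sub_right, div_mul_eq_mul_div, div_eq_iff hW0.ne']
      rw [hW]; ring
    rw [hy, inner_add_right, inner_add_right, inner_smul_right, h3, abs_le]
    constructor <;> linarith
  have hdisj : (Finset.range N : Set ℕ).PairwiseDisjoint S := by
    have key : ∀ k l : ℕ, k < l → Disjoint (S k) (S l) := by
      intro k l hkl
      rw [Set.disjoint_left]
      intro y hk hl
      have h1 := abs_le.1 (hbound k y hk)
      have h2 := abs_le.1 (hbound l y hl)
      have h3 : (k : ℝ) + 1 ≤ l := by exact_mod_cast hkl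
      nlinarith
    intro k _ l _ hkl
    rcases lt_or_gt_of_ne hkl with h | h
    · exact key k l h
    · exact (key l k h).symm
  have hvol : ∀ k, volume.real (S k) = (1 / 2) ^ d * volume.real (macbeath K x 1) := by
    intro k
    rw [← volume_macbeath _ (by norm_num), Measure.real, hS, measure_preimage_add_right,
      Measure.real]
  have hmeas : ∀ k ∈ Finset.range N, MeasurableSet (S k) := fun k _ =>
    (isCompact_macbeath hK x _).measurableSet.preimage (by fun_prop)
  have h1 := measureReal_biUnion_finset (μ := volume) hdisj hmeas
    (fun k hk => ((measure_mono (hSD k hk)).trans_lt hD.measure_lt_top).ne)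
  have h2 : volume.real (⋃ k ∈ Finset.range N, S k) ≤ A :=
    (volume_real_mono hD (Set.iUnion₂_subset hSD)).trans hA
  rw [h1] at h2
  simp only [hvol, Finset.sum_const, Finset.card_range, nsmul_eq_mul] at h2
  have h3 : W / (4 * t) ≤ N := by
    rw [hN]; push_cast
    exact (Nat.lt_floor_add_one _).le
  have h4 : W / (4 * t) * ((1 / 2) ^ d * B) ≤ A := by
    refine le_trans ?_ h2
    gcongr
  have h5 : W * B ≤ 2 ^ (d + 2) * A * t := by
    have h6 := mul_le_mul_of_nonneg_left h4 (show (0 : ℝ) ≤ 4 * t * 2 ^ d by positivity)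
    have h7 : 4 * t * 2 ^ d * (W / (4 * t) * ((1 / 2) ^ d * B)) = W * B := by
      rw [one_div, inv_pow]; field_simp
    rw [h7] at h6
    rw [pow_add]
    linarith
  rw [← le_div_iff₀ hB0] at h5
  calc W ≤ _ := h5
    _ = _ := by ring

theorem interior_nonempty_of_volume_real_pos {A : Set (E d)} (hc : Convex ℝ A)
    (h : 0 < volume.real A) : (interior A).Nonempty := by
  rw [Set.nonempty_iff_ne_empty]
  intro h0
  have : volume A = 0 := by
    refine measure_mono_null (fun y hy => ?_) (hc.addHaar_frontier volume)
    rw [frontier, h0]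
    exact ⟨subset_closure hy, id⟩
  simp [Measure.real, this] at h

/-! ### Floating bodies and their level surfaces. -/

/-- Pushing a half-space containing `z` outwards by `1/(n+1)` makes it contain nearby points of the
floating body. The volumes cut off then decrease to that of the original half-space. -/
theorem isClosed_floatingBody (hd : 0 < d) (hK : IsCompact K) (t : ℝ) :
    IsClosed (floatingBody K t) := by
  refine isClosed_of_closure_subset fun z hz => ⟨?_, ?_⟩
  · exact closure_minimal (fun y hy => hy.1) hK.isClosed hz
  refine le_v hd fun u c hu hzu => ?_
  set S : ℕ → Set (E d) := fun n => K ∩ halfSpace u (c - 1 / ((n : ℝ) + 1)) with hS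
  have hcpt : ∀ n, IsCompact (S n) := fun n => isCompact_inter_halfSpace hK _ _
  have hanti : Antitone S := by
    intro m n hmn x hx
    refine ⟨hx.1, ?_⟩
    have h1 := hx.2
    rw [mem_halfSpace] at *
    have := one_div_le_one_div_of_le (show (0 : ℝ) < (m : ℝ) + 1 by positivity)
      (show (m : ℝ) + 1 ≤ n + 1 by gcongr)
    linarith
  have hInter : ⋂ n, S n = K ∩ halfSpace u c := by
    ext x
    rw [Set.mem_iInter]
    constructor
    · intro h
      refine ⟨(h 0).1, ?_⟩
      rw [mem_halfSpace]
      refine le_of_forall_pos_lt_add fun ε hε => ?_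
      obtain ⟨n, hn⟩ := exists_nat_one_div_lt hε
      have := (mem_halfSpace.1 (h n).2)
      linarith
    · intro h n
      refine ⟨h.1, ?_⟩
      have h1 := h.2
      rw [mem_halfSpace] at *
      have : (0 : ℝ) < 1 / ((n : ℝ) + 1) := by positivity
      linarith
  have hlim := tendsto_measure_iInter_atTop (μ := volume) (s := S)
    (fun n => (hcpt n).measurableSet.nullMeasurableSet) hanti ⟨0, (hcpt 0).measure_lt_top.ne⟩
  rw [hInter] at hlim
  have hlim' := (ENNReal.tendsto_toReal
    (isCompact_inter_halfSpace hK u c).measure_lt_top.ne).comp hlim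
  refine ge_of_tendsto' hlim' fun n => ?_
  obtain ⟨y, hy, hyz⟩ := Metric.mem_closure_iff.1 hz (1 / ((n : ℝ) + 1)) (by positivity)
  refine hy.2.trans (v_le (K := K) (u := u) (c := c - 1 / ((n : ℝ) + 1))
    (fun h0 => by simp [h0] at hu) ?_)
  rw [mem_halfSpace] at *
  have h1 := real_inner_le_norm u (z - y)
  rw [hu, one_mul, ← dist_eq_norm, inner_sub_right] at h1
  linarith

theorem convex_floatingBody (hd : 0 < d) (hc : Convex ℝ K) (t : ℝ) :
    Convex ℝ (floatingBody K t) := by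
  intro x hx y hy p q hp hq hpq
  refine ⟨hc hx.1 hy.1 hp hq hpq, le_v hd fun u c hu h => ?_⟩
  have hu0 : u ≠ 0 := fun h0 => by simp [h0] at hu
  by_cases hxu : x ∈ halfSpace u c
  · exact hx.2.trans (v_le hu0 hxu)
  by_cases hyu : y ∈ halfSpace u c
  · exact hy.2.trans (v_le hu0 hyu)
  exfalso
  rw [mem_halfSpace] at *
  rw [inner_add_right, inner_smul_right, inner_smul_right] at h
  obtain rfl : q = 1 - p := by linarith
  rcases hp.eq_or_lt with rfl | hp
  · simp at h; exact hyu h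
  · nlinarith

theorem mem_interior_of_v_pos (hd : 0 < d) (hK : IsCompact K) (hc : Convex ℝ K) {x : E d}
    (h : 0 < v K x) : x ∈ interior K := by
  have h1 : 0 < volume.real (macbeath K x 1) :=
    pos_of_mul_pos_right (h.trans_le (v_le_volume_macbeath_one hd hK hc x)) (by positivity)
  obtain ⟨p, hp⟩ := interior_nonempty_of_volume_real_pos (convex_macbeath_one hc x) h1
  have h2 := (mem_macbeath_one.1 (interior_subset hp)).2
  have h3 := interior_mono (macbeath_one_subset x) hp
  have := hc.combo_interior_self_mem_interior h3 h2 (a := 1 / 2) (b := 1 / 2)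
    (by norm_num) (by norm_num) (by norm_num)
  convert this using 1
  module

/-- Continuity of `v` is avoided: arbitrarily near `y` there is `z` with `v(z) < t` and `2z - y ∈
K`. Then `y ∈ M(z,1)` lies in the doubled cap of `z`, whose volume is at most `2^d t`. -/
theorem v_bounds_of_mem_levelSurface (hd : 0 < d) (hK : IsCompact K) (hc : Convex ℝ K) {t : ℝ}
    (ht : 0 < t) {y : E d} (hy : y ∈ levelSurface K t) : t ≤ v K y ∧ v K y ≤ 2 ^ d * t := by
  have hyF : y ∈ floatingBody K t := (isClosed_floatingBody hd hK t).frontier_subset hy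
  refine ⟨hyF.2, ?_⟩
  have hyint := mem_interior_of_v_pos hd hK hc (ht.trans_le hyF.2)
  have hU : interior K ∩ (fun z : E d => (2 : ℝ) • z - y) ⁻¹' interior K ∈ nhds y := by
    refine Filter.inter_mem (isOpen_interior.mem_nhds hyint) ?_
    refine (isOpen_interior.preimage (by fun_prop)).mem_nhds ?_
    rw [Set.mem_preimage]
    convert hyint using 1
    module
  have hnot : ¬ (interior K ∩ (fun z : E d => (2 : ℝ) • z - y) ⁻¹' interior K ⊆
      floatingBody K t) := fun hsub =>
    hy.2 (mem_interior_iff_mem_nhds.2 (Filter.mem_of_superset hU hsub))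
  obtain ⟨z, hz, hzF⟩ := Set.not_subset.1 hnot
  have hzv : v K z < t := by
    by_contra! h
    exact hzF ⟨interior_subset hz.1, h⟩
  obtain ⟨u, c, hu, hzu, hvol⟩ := exists_halfSpace_of_v_lt hd hzv
  have hu0 : u ≠ 0 := fun h0 => by simp [h0] at hu
  rw [inter_halfSpace_eq_cap] at hvol
  have hzc : z ∈ cap K u (supportFn K u - c) := by
    rw [← inter_halfSpace_eq_cap]; exact ⟨interior_subset hz.1, hzu⟩
  have hyc := macbeath_one_subset_cap hK hzc
    (mem_macbeath_one.2 ⟨hyF.1, interior_subset hz.2⟩)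
  refine (v_le hu0 hyc.2).trans ?_
  refine (volume_cap_mul_le hK hc u one_le_two).trans ?_
  gcongr

/-- A half-space containing the segment and missing the floating body cuts off only points with `v <
τ`. Their Macbeath regions have volume at most `2τ`, so the averaging bound applies to the whole
cap. -/
theorem exists_cap_of_segment_disjoint (hd : 0 < d) (hK : IsCompact K) (hc : Convex ℝ K) {τ : ℝ}
    (hτ : 0 ≤ τ) {a b : E d} (ha : a ∈ K) (hb : b ∈ K)
    (h : Disjoint (segment ℝ a b) (floatingBody K τ)) :
    ∃ (u : E d) (r : ℝ), u ≠ 0 ∧ a ∈ cap K u r ∧ b ∈ cap K u r ∧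
      volume.real (cap K u r) ≤ 2 ^ (d + 1) * τ := by
  obtain ⟨u, c, hu, hau, hbu, hF⟩ : ∃ (u : E d) (c : ℝ), u ≠ 0 ∧ a ∈ halfSpace u c ∧
      b ∈ halfSpace u c ∧ ∀ y ∈ floatingBody K τ, y ∉ halfSpace u c := by
    -- Separation from an empty set could return the zero functional, so any direction is taken
    -- there.
    rcases (floatingBody K τ).eq_empty_or_nonempty with h0 | ⟨y₀, hy₀⟩
    · obtain ⟨u, hu⟩ := exists_unit hd
      refine ⟨u, min (inner ℝ u a) (inner ℝ u b), fun h0 => by simp [h0] at hu,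
        mem_halfSpace.2 (min_le_left _ _), mem_halfSpace.2 (min_le_right _ _), ?_⟩
      simp [h0]
    · have hseg : IsCompact (segment ℝ a b) := by
        rw [segment_eq_image_lineMap]
        exact isCompact_Icc.image (AffineMap.lineMap_continuous)
      obtain ⟨f, p, q, hf1, hpq, hf2⟩ := geometric_hahn_banach_compact_closed
        (convex_segment a b) hseg (convex_floatingBody hd hc τ)
        (isClosed_floatingBody hd hK τ) h
      set w := (InnerProductSpace.toDual ℝ (E d)).symm f with hw
      have hfw : ∀ y, inner ℝ w y = f y := fun y => InnerProductSpace.toDual_symm_apply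
      have h1 := hf1 a (left_mem_segment ℝ a b)
      have h2 := hf1 b (right_mem_segment ℝ a b)
      refine ⟨-w, -p, ?_, ?_, ?_, ?_⟩
      · rw [neg_ne_zero]
        rintro hw0
        have h3 := hf2 y₀ hy₀
        rw [← hfw, hw0] at h1 h3
        simp at h1 h3
        linarith
      · rw [mem_halfSpace, inner_neg_left, hfw]; linarith
      · rw [mem_halfSpace, inner_neg_left, hfw]; linarith
      · intro y hy
        have h3 := hf2 y hy
        rw [mem_halfSpace, inner_neg_left, hfw]; linarith
  refine ⟨u, supportFn K u - c, hu, ?_, ?_, ?_⟩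
  · rw [← inter_halfSpace_eq_cap]; exact ⟨ha, hau⟩
  · rw [← inter_halfSpace_eq_cap]; exact ⟨hb, hbu⟩
  rw [← inter_halfSpace_eq_cap]
  have hAc := isCompact_inter_halfSpace hK u c
  have h1 : volume (K ∩ halfSpace u c) ≤ 2 ^ d * ENNReal.ofReal (2 * τ) := by
    refine volume_le_of_volume_macbeath_le hAc (hc.inter (convex_halfSpace _ _)) ?_
    refine Filter.Eventually.of_forall fun y hy => ?_
    have h2 : v K y < τ := by
      by_contra! h3
      exact hF y ⟨hy.1, h3⟩ hy.2
    have h3 := volume_macbeath_one_le hd hK y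
    refine (measure_mono (macbeath_one_mono Set.inter_subset_left y)).trans ?_
    rw [← ENNReal.ofReal_toReal (isCompact_macbeath_one hK y).measure_lt_top.ne]
    exact ENNReal.ofReal_le_ofReal (h3.trans (by linarith))
  have h3 := ENNReal.toReal_mono (by finiteness) h1
  rw [ENNReal.toReal_mul, ENNReal.toReal_ofReal (by linarith)] at h3
  rw [pow_succ, mul_assoc]
  simpa [Measure.real] using h3

theorem le_volume_macbeath_inter_cap (hd : 0 < d) (hK : IsCompact K) (hc : Convex ℝ K)
    {y u : E d} {t : ℝ} (h : IsMinimalCap K y u t) :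
    v K y ≤ (2 * (4 * (d + 1)) ^ d) * volume.real (macbeath K y (1 / 2) ∩ cap K u t) := by
  have h1 := v_le_volume_macbeath_one hd hK hc y
  have h2 := volume_macbeath_inter_halfSpace (K := K) (l := 1 / 2) hK h.2.1.2
  have h3 : macbeath K y (1 / 2) ∩ cap K u t =
      macbeath K y (1 / 2) ∩ halfSpace u (supportFn K u - t) := by
    rw [cap, ← Set.inter_assoc, Set.inter_eq_left.2 (macbeath_subset hc y _ _)] <;> norm_num
  rw [← h3, volume_macbeath _ (by norm_num)] at h2
  have h4 : volume.real (macbeath K y 1) =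
      2 ^ d * ((1 / 2) ^ d * volume.real (macbeath K y 1)) := by
    rw [← mul_assoc, ← mul_pow]; norm_num
  rw [h4] at h1
  have h5 : ((2 : ℝ) * (d + 1)) ^ d * 2 ^ d = (4 * (d + 1)) ^ d := by
    rw [← mul_pow]; ring
  calc v K y ≤ _ := h1
    _ = (4 * (d + 1)) ^ d * ((1 / 2) ^ d * volume.real (macbeath K y 1)) := by
        rw [← h5]; ring
    _ ≤ (4 * (d + 1)) ^ d * (2 * volume.real (macbeath K y (1 / 2) ∩ cap K u t)) := by gcongr
    _ = _ := by ring

/-- If `k ∉ J`, disjointness of interiors puts the interior of `A` inside finitely many frontiers of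
closed sets, a union with empty interior. This recovers visibility of the cell `k` from a mere
inclusion of unions. -/
theorem mem_of_interior_nonempty_of_subset_iUnion {X ι : Type*} [TopologicalSpace X] [Finite ι]
    {S : ι → Set X} (hS : ∀ i, IsClosed (S i))
    (hdisj : Pairwise fun i j => Disjoint (interior (S i)) (interior (S j)))
    {A : Set X} (hA : (interior A).Nonempty) {k : ι} (hAk : A ⊆ S k) {J : Set ι}
    (hcov : A ⊆ ⋃ j ∈ J, S j) : k ∈ J := by
  by_contra hk
  have hfin : ∀ J : Set ι, J.Finite → IsClosed (⋃ j ∈ J, frontier (S j)) ∧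
      interior (⋃ j ∈ J, frontier (S j)) = ∅ := by
    intro J hJ
    refine ⟨hJ.isClosed_biUnion fun _ _ => isClosed_frontier, ?_⟩
    induction J, hJ using Set.Finite.induction_on with
    | empty => simp
    | @insert j J _ hJ ih =>
      rw [Set.biUnion_insert, interior_union_isClosed_of_interior_empty isClosed_frontier ih,
        interior_frontier (hS j)]
  have hsub : interior A ⊆ ⋃ j ∈ J, frontier (S j) := by
    intro x hx
    obtain ⟨j, hj, hxj⟩ := Set.mem_iUnion₂.1 (hcov (interior_subset hx))
    refine Set.mem_iUnion₂.2 ⟨j, hj, subset_closure hxj, fun hxi => ?_⟩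
    exact Set.disjoint_left.1 (hdisj (show k ≠ j by rintro rfl; exact hk hj))
      (interior_mono hAk hx) hxi
  have h1 := interior_maximal hsub isOpen_interior
  rw [(hfin J J.toFinite).2] at h1
  exact hA.ne_empty (Set.subset_empty_iff.1 h1)

/-! ### Faces of a polytope and the covering by flag simplices. -/

theorem convexHull_inter_halfSpace_eq {V : Finset (E d)} {u : E d} {c : ℝ}
    (h : ∀ v ∈ V, inner ℝ u v ≤ c) :
    convexHull ℝ (V : Set (E d)) ∩ halfSpace u c =
      convexHull ℝ (V.filter (fun v => inner ℝ u v = c) : Set (E d)) := by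
  apply Set.Subset.antisymm
  · rintro x ⟨hx, hxc⟩
    rw [mem_halfSpace] at hxc
    obtain ⟨w, hw, hw1, hwx⟩ := Finset.mem_convexHull'.1 hx
    have h1 : ∑ v ∈ V, w v * (c - inner ℝ u v) = c - inner ℝ u x := by
      simp only [mul_sub, Finset.sum_sub_distrib, ← Finset.sum_mul, hw1, one_mul]
      rw [← hwx, inner_sum]
      simp [inner_smul_right]
    have h2 : ∀ v ∈ V, 0 ≤ w v * (c - inner ℝ u v) := fun v hv =>
      mul_nonneg (hw v hv) (sub_nonneg.2 (h v hv))
    have h3 : ∀ v ∈ V, w v * (c - inner ℝ u v) = 0 :=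
      (Finset.sum_eq_zero_iff_of_nonneg h2).1 (le_antisymm (by linarith) (Finset.sum_nonneg h2))
    have h4 : ∀ v ∈ V, w v ≠ 0 → inner ℝ u v = c := by
      intro v hv hwv
      have := (mul_eq_zero.1 (h3 v hv)).resolve_left hwv
      linarith
    refine Finset.mem_convexHull'.2 ⟨w, fun v hv => hw v (Finset.mem_filter.1 hv).1, ?_, ?_⟩
    · rw [Finset.sum_filter_of_ne h4, hw1]
    · rw [Finset.sum_filter_of_ne fun v hv hne => h4 v hv (left_ne_zero_of_smul hne), hwx]
  · refine convexHull_min (fun v hv => ?_) ((convex_convexHull ℝ _).inter (convex_halfSpace u c))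
    have hv' := Finset.mem_filter.1 hv
    exact ⟨subset_convexHull ℝ _ hv'.1, mem_halfSpace.2 hv'.2.ge⟩

theorem inner_le_of_mem_convexHull {V : Set (E d)} {u : E d} {c : ℝ}
    (h : ∀ v ∈ V, inner ℝ u v ≤ c) {x : E d} (hx : x ∈ convexHull ℝ V) : inner ℝ u x ≤ c := by
  have h1 : V ⊆ halfSpace (-u) (-c) := fun v hv => by
    rw [mem_halfSpace, inner_neg_left]
    exact neg_le_neg (h v hv)
  have h2 := convexHull_min h1 (convex_halfSpace _ _) hx
  rw [mem_halfSpace, inner_neg_left] at h2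
  exact neg_le_neg_iff.1 h2

/-- `A` is the vertex set of a nonempty face of the polytope spanned by `V`. -/
def IsFacial (V A : Finset (E d)) : Prop :=
  A.Nonempty ∧ ∃ (u : E d) (c : ℝ), (∀ v ∈ V, inner ℝ u v ≤ c) ∧
    A = V.filter (fun v => inner ℝ u v = c)

theorem vectorSpan_convexHull_eq (A : Set (E d)) :
    vectorSpan ℝ (convexHull ℝ A) = vectorSpan ℝ A := by
  rw [← direction_affineSpan, affineSpan_convexHull, direction_affineSpan]

theorem sub_mem_vectorSpan_of_mem_convexHull {A : Set (E d)} {x y : E d}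
    (hx : x ∈ convexHull ℝ A) (hy : y ∈ convexHull ℝ A) : x - y ∈ vectorSpan ℝ A := by
  rw [← vectorSpan_convexHull_eq]
  exact vsub_mem_vectorSpan ℝ hx hy

theorem IsFacial.isFaceOfDim {V A : Finset (E d)} (h : IsFacial V A) :
    IsFaceOfDim (convexHull ℝ (V : Set (E d))) (convexHull ℝ (A : Set (E d)))
      (Module.finrank ℝ (vectorSpan ℝ (A : Set (E d)))) := by
  obtain ⟨⟨a, ha⟩, u, c, hu, rfl⟩ := h
  refine ⟨⟨a, subset_convexHull ℝ _ ha⟩, fun _ => ⟨innerSL ℝ u, ?_⟩, by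
    rw [vectorSpan_convexHull_eq]⟩
  rw [← convexHull_inter_halfSpace_eq hu]
  obtain ⟨haV, hac⟩ := Finset.mem_filter.1 ha
  ext x
  constructor
  · rintro ⟨hx, hxc⟩
    refine ⟨hx, fun y hy => ?_⟩
    exact (inner_le_of_mem_convexHull hu hy).trans (mem_halfSpace.1 hxc)
  · rintro ⟨hx, hmax⟩
    refine ⟨hx, mem_halfSpace.2 ?_⟩
    rw [← hac]
    exact hmax a (subset_convexHull ℝ _ haV)

/-- Each face is the hull of a subset of `V`. Finiteness matters because `ncard` of an infinite set
is zero. -/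
theorem finite_flags {P : Set (E d)} (hP : IsPolytope P) : (flags P).Finite := by
  obtain ⟨V, rfl⟩ := hP
  have hfin : ((fun A : Finset (E d) => convexHull ℝ (A : Set (E d))) ''
      (V.powerset : Set (Finset (E d)))).Finite := (Finset.finite_toSet _).image _
  refine (Set.Finite.pi (fun _ : Fin d => hfin)).subset fun F hF i _ => ?_
  obtain ⟨⟨x, hx⟩, hexp, -⟩ := hF.1 i
  obtain ⟨l, hl⟩ := hexp ⟨x, hx⟩
  set u := (InnerProductSpace.toDual ℝ (E d)).symm l with hu
  have hul : ∀ y, inner ℝ u y = l y := fun y => InnerProductSpace.toDual_symm_apply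
  rw [hl] at hx
  have hmax : ∀ v ∈ V, inner ℝ u v ≤ l x := fun v hv => by
    rw [hul]
    exact hx.2 v (subset_convexHull ℝ _ hv)
  refine ⟨V.filter (fun v => inner ℝ u v = l x),
    Finset.mem_powerset.2 (Finset.filter_subset _ _), ?_⟩
  simp only
  rw [← convexHull_inter_halfSpace_eq hmax, hl]
  ext y
  rw [Set.mem_inter_iff, mem_halfSpace, hul]
  constructor
  · rintro ⟨hy, hyx⟩
    exact ⟨hy, fun z hz => (hx.2 z hz).trans hyx⟩
  · rintro ⟨hy, hyx⟩
    exact ⟨hy, hyx x hx.1⟩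

/-- Inside its own span `G` has interior points, and `q` is not one since the ray from `p` leaves
`G` there. Hahn–Banach in that span gives a normal that is nonzero along `G`. -/
theorem exists_supporting_of_exit {G : Set (E d)} (hG : Convex ℝ G) {p q : E d} (hp : p ∈ G)
    (hq : q ∈ G) (hout : ∀ ε > (0 : ℝ), q + ε • (q - p) ∉ G) :
    ∃ u ∈ vectorSpan ℝ G, u ≠ 0 ∧ ∀ y ∈ G, inner ℝ u y ≤ inner ℝ u q := by
  set W := vectorSpan ℝ G with hW
  set A : Set W := {y | p + (y : E d) ∈ G} with hA
  have hAc : Convex ℝ A := by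
    intro x hx y hy a b ha hb hab
    change p + ((a • x + b • y : W) : E d) ∈ G
    convert hG hx hy ha hb hab using 1
    obtain rfl : b = 1 - a := by linarith
    simp only [Submodule.coe_add, Submodule.coe_smul]
    module
  have hmem : ∀ y ∈ G, y - p ∈ W := fun y hy => vsub_mem_vectorSpan ℝ hy hp
  have hmemA : ∀ y (hy : y ∈ G), (⟨y - p, hmem y hy⟩ : W) ∈ A := fun y hy => by
    change p + (y - p) ∈ G
    simpa using hy
  have hspan : vectorSpan ℝ A = ⊤ := by
    rw [eq_top_iff]
    rintro ⟨y, hy⟩ -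
    have hle : W ≤ (vectorSpan ℝ A).map W.subtype := by
      refine Submodule.span_le.2 ?_
      rintro _ ⟨a, ha, b, hb, rfl⟩
      refine ⟨_, vsub_mem_vectorSpan ℝ (hmemA a ha) (hmemA b hb), ?_⟩
      simp
    obtain ⟨y', hy', hyy⟩ := hle hy
    have : (⟨y, hy⟩ : W) = y' := Subtype.ext hyy.symm
    rwa [this]
  have hne : A.Nonempty := ⟨_, hmemA p hp⟩
  have hint : (interior A).Nonempty := by
    rw [hAc.interior_nonempty_iff_affineSpan_eq_top,
      AffineSubspace.affineSpan_eq_top_iff_vectorSpan_eq_top_of_nonempty ℝ W W hne]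
    exact hspan
  set w : W := ⟨q - p, hmem q hq⟩ with hw
  have hnot : w ∉ interior A := by
    intro hwi
    have hcont : Filter.Tendsto (fun ε : ℝ => w + ε • w) (nhdsWithin 0 (Set.Ioi 0)) (nhds w) := by
      have : Continuous fun ε : ℝ => w + ε • w := by fun_prop
      have h := this.tendsto 0
      simp only [zero_smul, add_zero] at h
      exact h.mono_left nhdsWithin_le_nhds
    obtain ⟨ε, hε, hε0⟩ := ((hcont.eventually (isOpen_interior.mem_nhds hwi)).and
      self_mem_nhdsWithin).exists
    have h1 : p + ((w + ε • w : W) : E d) ∈ G := interior_subset (s := A) hε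
    refine hout ε hε0 ?_
    convert h1 using 1
    simp only [hw, Submodule.coe_add, Submodule.coe_smul]
    module
  obtain ⟨f, hf, hfw⟩ := geometric_hahn_banach_of_nonempty_interior_point hAc hnot hint
  set u := (InnerProductSpace.toDual ℝ W).symm f with hu
  have hfu : ∀ y : W, inner ℝ (u : E d) (y : E d) = f y := fun y => by
    rw [← Submodule.coe_inner]
    exact InnerProductSpace.toDual_symm_apply
  refine ⟨u, u.2, ?_, fun y hy => ?_⟩
  · rw [Ne, Submodule.coe_eq_zero, hu, LinearIsometryEquiv.map_eq_zero_iff]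
    exact hf
  · have h1 := hfw _ (hmemA y hy)
    rw [← hfu, ← hfu] at h1
    simp only [hw, inner_sub_right] at h1
    linarith

theorem exists_exit_point {G : Set (E d)} (hG : IsCompact G) {p z : E d} (hz : z ∈ G)
    (hpz : z ≠ p) :
    ∃ q ∈ G, z ∈ segment ℝ p q ∧ ∀ ε > (0 : ℝ), q + ε • (q - p) ∉ G := by
  set f : ℝ → E d := fun t => AffineMap.lineMap p z t with hf
  have hfc : Continuous f := AffineMap.lineMap_continuous
  obtain ⟨R, hR⟩ := hG.isBounded.exists_norm_le
  have hnz : 0 < ‖z - p‖ := norm_pos_iff.2 (sub_ne_zero.2 hpz)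
  have hfv : ∀ t, f t = p + t • (z - p) := fun t => by
    simp [hf, AffineMap.lineMap_apply, add_comm]
  have hbd : BddAbove (f ⁻¹' G ∩ Set.Ici 1) := by
    refine ⟨(R + ‖p‖) / ‖z - p‖, fun t ht => ?_⟩
    have ht1 : (1 : ℝ) ≤ t := ht.2
    rw [le_div_iff₀ hnz]
    have h1 : ‖t • (z - p)‖ ≤ ‖f t‖ + ‖p‖ := by
      have : t • (z - p) = f t - p := by rw [hfv]; module
      rw [this]; exact norm_sub_le _ _
    rw [norm_smul, Real.norm_of_nonneg (by linarith)] at h1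
    linarith [hR _ ht.1]
  have hcl : IsClosed (f ⁻¹' G ∩ Set.Ici 1) := (hG.isClosed.preimage hfc).inter isClosed_Ici
  have hne : (f ⁻¹' G ∩ Set.Ici 1).Nonempty := ⟨1, by simpa [hf] using hz, Set.mem_Ici.2 le_rfl⟩
  have hmem := hcl.csSup_mem hne hbd
  set t := sSup (f ⁻¹' G ∩ Set.Ici 1) with ht
  have ht1 : (1 : ℝ) ≤ t := hmem.2
  have ht0 : 0 < t := by linarith
  refine ⟨f t, hmem.1, ?_, fun ε hε hcon => ?_⟩
  · rw [segment_eq_image']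
    refine ⟨t⁻¹, ⟨(inv_pos.2 ht0).le, inv_le_one_of_one_le₀ ht1⟩, ?_⟩
    simp only
    rw [hfv, add_sub_cancel_left, smul_smul, inv_mul_cancel₀ ht0.ne']
    simp
  · have h1 : f (t + ε * t) ∈ G := by
      convert hcon using 1
      rw [hfv, hfv]
      module
    have h2 := le_csSup hbd ⟨h1, Set.mem_Ici.2 (by nlinarith)⟩
    rw [← ht] at h2
    nlinarith

/-- Take a supporting normal at `w` touching the most points of `A`. If the contact set had
codimension above one, the normal could be tilted in a direction `m` orthogonal to it until another
point is touched. -/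
theorem exists_facet_of_supporting {A : Finset (E d)} {w : E d}
    (hw : w ∈ convexHull ℝ (A : Set (E d)))
    (hu : ∃ u ∈ vectorSpan ℝ (A : Set (E d)), u ≠ 0 ∧ ∀ v ∈ A, inner ℝ u v ≤ inner ℝ u w) :
    ∃ u : E d, (∀ v ∈ A, inner ℝ u v ≤ inner ℝ u w) ∧
      Module.finrank ℝ (vectorSpan ℝ
        (A.filter (fun v => inner ℝ u v = inner ℝ u w) : Set (E d))) + 1 =
        Module.finrank ℝ (vectorSpan ℝ (A : Set (E d))) := by
  classical
  set W := vectorSpan ℝ (A : Set (E d)) with hW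
  let good : E d → Prop := fun u => u ∈ W ∧ u ≠ 0 ∧ ∀ v ∈ A, inner ℝ u v ≤ inner ℝ u w
  let B : E d → Finset (E d) := fun u => A.filter (fun v => inner ℝ u v = inner ℝ u w)
  obtain ⟨B₀, hB₀, hmax⟩ := Finset.exists_max_image
    (A.powerset.filter fun S => ∃ u, good u ∧ S = B u) Finset.card (by
      obtain ⟨u, hu⟩ := hu
      exact ⟨B u, Finset.mem_filter.2 ⟨Finset.mem_powerset.2 (Finset.filter_subset _ _),
        u, hu, rfl⟩⟩)
  obtain ⟨-, u, hgood, rfl⟩ := Finset.mem_filter.1 hB₀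
  obtain ⟨huW, hu0, hule⟩ := hgood
  refine ⟨u, hule, ?_⟩
  change Module.finrank ℝ (vectorSpan ℝ (B u : Set (E d))) + 1 = _
  have hwB : w ∈ convexHull ℝ (B u : Set (E d)) := by
    rw [← convexHull_inter_halfSpace_eq hule]
    exact ⟨hw, mem_halfSpace.2 le_rfl⟩
  set N := vectorSpan ℝ (B u : Set (E d)) with hN
  set M := (ℝ ∙ u)ᗮ ⊓ W with hM
  have hfr : 1 + Module.finrank ℝ M = Module.finrank ℝ W := by
    rw [← finrank_span_singleton (K := ℝ) hu0]
    exact Submodule.finrank_add_inf_finrank_orthogonal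
      ((Submodule.span_singleton_le_iff_mem u W).2 huW)
  have hNM : N ≤ M := by
    refine le_inf ?_ (vectorSpan_mono ℝ (by exact_mod_cast Finset.filter_subset _ _))
    rw [hN, vectorSpan_def, Submodule.span_le]
    rintro _ ⟨a, ha, b, hb, rfl⟩
    rw [SetLike.mem_coe, Submodule.mem_orthogonal_singleton_iff_inner_right]
    simp only [vsub_eq_sub, inner_sub_right]
    rw [(Finset.mem_filter.1 ha).2, (Finset.mem_filter.1 hb).2, sub_self]
  suffices hbot : Nᗮ ⊓ M = ⊥ by
    have h1 := Submodule.finrank_add_inf_finrank_orthogonal hNM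
    rw [hbot, finrank_bot, add_zero] at h1
    rw [h1, add_comm, hfr]
  by_contra hne
  obtain ⟨m, hm, hm0⟩ := Submodule.exists_mem_ne_zero_of_ne_bot hne
  obtain ⟨v₁, hv₁, hv₁m⟩ : ∃ v ∈ A, inner ℝ m (v - w) ≠ 0 := by
    by_contra! hcon
    have h1 : W ≤ (ℝ ∙ m)ᗮ := by
      rw [hW, vectorSpan_def, Submodule.span_le]
      rintro _ ⟨a, ha, b, hb, rfl⟩
      rw [SetLike.mem_coe, Submodule.mem_orthogonal_singleton_iff_inner_right]
      have h2 := hcon a ha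
      have h3 := hcon b hb
      simp only [vsub_eq_sub, inner_sub_right] at *
      linarith
    have h2 := Submodule.mem_orthogonal_singleton_iff_inner_right.1 (h1 hm.2.2)
    exact hm0 (inner_self_eq_zero.1 h2)
  obtain ⟨m, hm, v₁, hv₁, hv₁m⟩ : ∃ m ∈ Nᗮ ⊓ M, ∃ v ∈ A, 0 < inner ℝ m (v - w) := by
    rcases lt_or_gt_of_ne hv₁m with h | h
    · exact ⟨-m, neg_mem hm, v₁, hv₁, by rw [inner_neg_left]; linarith⟩
    · exact ⟨m, hm, v₁, hv₁, h⟩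
  have hmB : ∀ v ∈ B u, inner ℝ m (v - w) = 0 := fun v hv => by
    rw [real_inner_comm]
    exact (Submodule.mem_orthogonal _ _).1 hm.1 _
      (sub_mem_vectorSpan_of_mem_convexHull (subset_convexHull ℝ _ hv) hwB)
  have hum : inner ℝ u m = 0 := Submodule.mem_orthogonal_singleton_iff_inner_right.1 hm.2.1
  obtain ⟨v₂, hv₂, hmin⟩ := Finset.exists_min_image
    (A.filter fun v => 0 < inner ℝ m (v - w))
    (fun v => inner ℝ u (w - v) / inner ℝ m (v - w)) ⟨v₁, Finset.mem_filter.2 ⟨hv₁, hv₁m⟩⟩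
  obtain ⟨hv₂A, hv₂m⟩ := Finset.mem_filter.1 hv₂
  -- The smallest ratio is the first tilt at which a new point, `v₂`, is touched; no point has
  -- crossed the hyperplane yet.
  set τ := inner ℝ u (w - v₂) / inner ℝ m (v₂ - w) with hτ
  have hnn : ∀ v ∈ A, 0 ≤ inner ℝ u (w - v) := fun v hv => by
    rw [inner_sub_right]; linarith [hule v hv]
  have hτ0 : 0 ≤ τ := div_nonneg (hnn _ hv₂A) hv₂m.le
  have hval : ∀ v, inner ℝ (u + τ • m) v - inner ℝ (u + τ • m) w =
      - inner ℝ u (w - v) + τ * inner ℝ m (v - w) := fun v => by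
    simp only [inner_add_left, inner_smul_left, inner_sub_right, conj_trivial]
    ring
  have hgood' : good (u + τ • m) := by
    refine ⟨W.add_mem huW (W.smul_mem _ hm.2.2), fun h0 => hu0 ?_, fun v hv => ?_⟩
    · have h1 : inner ℝ u (u + τ • m) = 0 := by rw [h0, inner_zero_right]
      rw [inner_add_right, inner_smul_right, hum, mul_zero, add_zero] at h1
      exact inner_self_eq_zero.1 h1
    · rw [← sub_nonpos, hval]
      rcases le_or_gt (inner ℝ m (v - w)) 0 with h | h
      · have := hnn v hv
        have := mul_nonpos_of_nonneg_of_nonpos hτ0 h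
        linarith
      · have h1 := hmin v (Finset.mem_filter.2 ⟨hv, h⟩)
        rw [le_div_iff₀ h] at h1
        linarith
  have hsub : B u ⊆ B (u + τ • m) := fun v hv => by
    obtain ⟨hvA, hvu⟩ := Finset.mem_filter.1 hv
    refine Finset.mem_filter.2 ⟨hvA, ?_⟩
    rw [← sub_eq_zero, hval, hmB v hv, inner_sub_right, hvu]
    simp
  have hv₂' : v₂ ∈ B (u + τ • m) := by
    refine Finset.mem_filter.2 ⟨hv₂A, ?_⟩
    rw [← sub_eq_zero, hval, hτ, div_mul_cancel₀ _ hv₂m.ne']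
    ring
  have hcard : (B u).card < (B (u + τ • m)).card :=
    Finset.card_lt_card ⟨hsub, fun h => hv₂m.ne' (hmB v₂ (h hv₂'))⟩
  have := hmax (B (u + τ • m)) (Finset.mem_filter.2
    ⟨Finset.mem_powerset.2 (Finset.filter_subset _ _), _, hgood', rfl⟩)
  omega

/-- A face of a face is a face: tilting the outer normal by a small `ε • u` leaves the finitely many
points outside `A` strictly below. -/
theorem IsFacial.of_facial {V A : Finset (E d)} (hA : IsFacial V A) {u w : E d}
    (hu : ∀ v ∈ A, inner ℝ u v ≤ inner ℝ u w)
    (hw : w ∈ convexHull ℝ (A : Set (E d))) :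
    IsFacial V (A.filter (fun v => inner ℝ u v = inner ℝ u w)) := by
  obtain ⟨hne, u₀, c₀, hu₀, hAV⟩ := hA
  constructor
  · rw [← Finset.coe_nonempty, ← convexHull_nonempty_iff (𝕜 := ℝ),
      ← convexHull_inter_halfSpace_eq hu]
    exact ⟨w, hw, mem_halfSpace.2 le_rfl⟩
  have hev : ∀ᶠ ε in nhdsWithin (0 : ℝ) (Set.Ioi 0), ∀ v ∈ V, v ∉ A →
      inner ℝ u₀ v + ε * (inner ℝ u v - inner ℝ u w) < c₀ := by
    rw [Filter.eventually_all_finset]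
    intro v hv
    by_cases hvA : v ∈ A
    · exact Filter.Eventually.of_forall fun _ h => absurd hvA h
    have hlt : inner ℝ u₀ v < c₀ := by
      refine (hu₀ v hv).lt_of_ne fun h => hvA ?_
      rw [hAV]
      exact Finset.mem_filter.2 ⟨hv, h⟩
    have hcont : Continuous fun ε : ℝ => inner ℝ u₀ v + ε * (inner ℝ u v - inner ℝ u w) := by
      fun_prop
    have h1 := hcont.tendsto 0
    simp only [zero_mul, add_zero] at h1
    filter_upwards [(h1.mono_left nhdsWithin_le_nhds).eventually (gt_mem_nhds hlt)] with ε hε _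
      using hε
  obtain ⟨ε, hε, hε0⟩ := (hev.and self_mem_nhdsWithin).exists
  have hε0 : 0 < ε := hε0
  have hAu : ∀ v ∈ A, v ∈ V ∧ inner ℝ u₀ v = c₀ := fun v hv => by
    rw [hAV] at hv; exact Finset.mem_filter.1 hv
  have hval : ∀ v, inner ℝ (u₀ + ε • u) v = inner ℝ u₀ v + ε * inner ℝ u v := fun v => by
    simp [inner_add_left, inner_smul_left]
  refine ⟨u₀ + ε • u, c₀ + ε * inner ℝ u w, fun v hv => ?_, ?_⟩
  · rw [hval]
    by_cases hvA : v ∈ A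
    · rw [(hAu v hvA).2]
      have := hu v hvA
      gcongr
    · have := hε v hv hvA
      linarith
  · ext v
    rw [Finset.mem_filter, Finset.mem_filter, hval]
    constructor
    · rintro ⟨hv, h⟩
      exact ⟨(hAu v hv).1, by rw [(hAu v hv).2, h]⟩
    · rintro ⟨hv, h⟩
      by_cases hvA : v ∈ A
      · rw [(hAu v hvA).2, add_right_inj, mul_right_inj' hε0.ne'] at h
        exact ⟨hvA, h⟩
      · have := hε v hv hvA
        linarith

theorem IsFacial.exists_facet {V A : Finset (E d)} (hA : IsFacial V A) {k : ℕ}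
    (hk : Module.finrank ℝ (vectorSpan ℝ (A : Set (E d))) = k + 1) {p z : E d}
    (hp : p ∈ convexHull ℝ (A : Set (E d))) (hz : z ∈ convexHull ℝ (A : Set (E d))) :
    ∃ A' ⊆ A, IsFacial V A' ∧ Module.finrank ℝ (vectorSpan ℝ (A' : Set (E d))) = k ∧
      ∃ w ∈ convexHull ℝ (A' : Set (E d)), z ∈ segment ℝ p w := by
  have hcpt : IsCompact (convexHull ℝ (A : Set (E d))) :=
    (Finset.finite_toSet A).isCompact_convexHull ℝ
  obtain ⟨w, hw, hzw, hout⟩ : ∃ w ∈ convexHull ℝ (A : Set (E d)), z ∈ segment ℝ p w ∧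
      ∀ ε > (0 : ℝ), w + ε • (w - p) ∉ convexHull ℝ (A : Set (E d)) := by
    rcases ne_or_eq z p with h | rfl
    · exact exists_exit_point hcpt hz h
    · obtain ⟨q, hq, hqz⟩ : ∃ q ∈ convexHull ℝ (A : Set (E d)), q ≠ z := by
        by_contra! hcon
        have h1 : (A : Set (E d)).Subsingleton := fun a ha b hb =>
          (hcon a (subset_convexHull ℝ _ ha)).trans (hcon b (subset_convexHull ℝ _ hb)).symm
        rw [(vectorSpan_eq_bot_iff_subsingleton ℝ).2 h1, finrank_bot] at hk
        omega
      obtain ⟨w, hw, -, hout⟩ := exists_exit_point hcpt hq hqz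
      exact ⟨w, hw, left_mem_segment ℝ _ _, hout⟩
  obtain ⟨u, huW, hu0, hu⟩ := exists_supporting_of_exit (convex_convexHull ℝ _) hp hw hout
  rw [vectorSpan_convexHull_eq] at huW
  obtain ⟨u', hu', hfr⟩ := exists_facet_of_supporting hw
    ⟨u, huW, hu0, fun v hv => hu v (subset_convexHull ℝ _ hv)⟩
  refine ⟨_, Finset.filter_subset _ _, hA.of_facial hu' hw, by omega, w, ?_, hzw⟩
  rw [← convexHull_inter_halfSpace_eq hu']
  exact ⟨hw, mem_halfSpace.2 le_rfl⟩

/-- Project `z` from the chosen point of the face onto a facet and induct on dimension. The chosen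
points need not be relatively interior: the simplices may overlap or degenerate, since only covering
matters. -/
theorem IsFacial.exists_chain {V : Finset (E d)} {x : Set (E d) → E d}
    (hx : ∀ S : Set (E d), S.Nonempty → x S ∈ S) (k : ℕ) : ∀ {A : Finset (E d)}, IsFacial V A →
    Module.finrank ℝ (vectorSpan ℝ (A : Set (E d))) = k →
    ∀ {z : E d}, z ∈ convexHull ℝ (A : Set (E d)) →
    ∃ F : ℕ → Finset (E d), (∀ i ≤ k, IsFacial V (F i) ∧
      Module.finrank ℝ (vectorSpan ℝ (F i : Set (E d))) = i) ∧
      (∀ i j, i ≤ j → j ≤ k → F i ⊆ F j) ∧ F k = A ∧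
      z ∈ convexHull ℝ ((fun i => x (convexHull ℝ (F i : Set (E d)))) '' {i | i ≤ k}) := by
  induction k with
  | zero =>
    intro A hA hk z hz
    refine ⟨fun _ => A, fun i hi => ?_, fun _ _ _ _ => subset_rfl, rfl, ?_⟩
    · obtain rfl : i = 0 := by omega
      exact ⟨hA, hk⟩
    · have h1 := Submodule.finrank_eq_zero.1 hk
      have h2 := sub_mem_vectorSpan_of_mem_convexHull hz (hx _ ⟨z, hz⟩)
      rw [h1, Submodule.mem_bot, sub_eq_zero] at h2
      exact subset_convexHull ℝ _ ⟨0, Nat.le_refl 0, h2.symm⟩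
  | succ k ih =>
    intro A hA hk z hz
    obtain ⟨A', hA'A, hA', hk', w, hw, hzw⟩ := hA.exists_facet hk (hx _ ⟨z, hz⟩) hz
    obtain ⟨F, hF, hmono, hFk, hwF⟩ := ih hA' hk' hw
    have hlt : ∀ i, i ≤ k → i ≠ k + 1 := fun i hi => by omega
    refine ⟨fun i => if i = k + 1 then A else F i, fun i hi => ?_, fun i j hij hj => ?_, by simp,
      ?_⟩
    · by_cases h : i = k + 1
      · beta_reduce; rw [if_pos h, h]; exact ⟨hA, hk⟩
      · beta_reduce; rw [if_neg h]; exact hF i (by omega)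
    · by_cases h : j = k + 1
      · by_cases h' : i = k + 1
        · simp [h, h']
        · simp only [h, h', if_true, if_false]
          exact (hmono i k (by omega) le_rfl).trans (hFk ▸ hA'A)
      · simp only [h, show i ≠ k + 1 by omega, if_false]
        exact hmono i j hij (by omega)
    · refine (convex_convexHull ℝ _).segment_subset (subset_convexHull ℝ _ ?_)
        (convexHull_mono ?_ hwF) hzw
      · exact ⟨k + 1, Nat.le_refl _, by simp⟩
      · rintro _ ⟨i, hi, rfl⟩
        exact ⟨i, Nat.le_succ_of_le hi, by simp [hlt i hi]⟩

/-- A full-dimensional polytope is covered by one simplex for each of its flags. -/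
theorem exists_simplex_cover {P : Set (E d)} (hP : IsPolytope P) (hint : (interior P).Nonempty) :
    ∃ q : (Fin d → Set (E d)) → Fin (d + 1) → E d, (∀ f ∈ flags P, ∀ i, q f i ∈ P) ∧
      P ⊆ ⋃ f ∈ flags P, convexHull ℝ (Set.range (q f)) := by
  classical
  obtain ⟨V, rfl⟩ := hP
  set P := convexHull ℝ (V : Set (E d)) with hPdef
  have hPne : P.Nonempty := hint.mono interior_subset
  let x : Set (E d) → E d := fun S => if h : S.Nonempty then h.choose else 0
  have hx : ∀ S : Set (E d), S.Nonempty → x S ∈ S := fun S h => by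
    simp only [x, h, dif_pos]; exact h.choose_spec
  have hV : IsFacial V V := by
    refine ⟨?_, 0, 0, by simp, by simp⟩
    rw [← Finset.coe_nonempty, ← convexHull_nonempty_iff (𝕜 := ℝ)]
    exact hPne
  have hdim : Module.finrank ℝ (vectorSpan ℝ (V : Set (E d))) = d := by
    have h1 := interior_convexHull_nonempty_iff_affineSpan_eq_top.1 hint
    rw [← direction_affineSpan, h1, AffineSubspace.direction_top, finrank_top,
      finrank_euclideanSpace_fin]
  -- Flags stop at dimension `d - 1`; the last vertex is the chosen point of `P` itself.
  refine ⟨fun f => Fin.snoc (α := fun _ => E d) (fun i => x (f i)) (x P), fun f hf i => ?_,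
    fun z hz => ?_⟩
  · refine Fin.lastCases ?_ (fun i => ?_) i
    · simpa using hx P hPne
    · simp only [Fin.snoc_castSucc]
      obtain ⟨hne, hexp, -⟩ := hf.1 i
      exact hexp.subset (hx _ hne)
  · obtain ⟨F, hF, hmono, hFd, hzF⟩ := hV.exists_chain hx d hdim hz
    refine Set.mem_iUnion₂.2 ⟨fun i => convexHull ℝ (F i : Set (E d)), ⟨fun i => ?_, ?_⟩, ?_⟩
    · have h1 := (hF i i.2.le).1.isFaceOfDim
      rwa [(hF i i.2.le).2] at h1
    · intro i j hij
      exact convexHull_mono (by exact_mod_cast hmono i j hij j.2.le)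
    · refine convexHull_mono ?_ hzF
      rintro _ ⟨i, hi, rfl⟩
      have hi : i ≤ d := hi
      rcases hi.eq_or_lt with rfl | hlt
      · exact ⟨Fin.last _, by simp [hFd, hPdef]⟩
      · refine ⟨Fin.castSucc ⟨i, hlt⟩, ?_⟩
        simp only [Fin.snoc_castSucc]

/-! ### Truncating a simplex by a half-space. -/

theorem mem_convexHull_range_iff {ι : Type*} [Fintype ι] {p : ι → E d} {x : E d} :
    x ∈ convexHull ℝ (Set.range p) ↔
      ∃ w : ι → ℝ, (∀ i, 0 ≤ w i) ∧ ∑ i, w i = 1 ∧ ∑ i, w i • p i = x := by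
  classical
  constructor
  · intro hx
    have hsub : Set.range p ⊆ (Fintype.linearCombination ℝ p) '' stdSimplex ℝ ι := by
      rintro _ ⟨i, rfl⟩
      exact ⟨Pi.single i 1, single_mem_stdSimplex ℝ i, by
        simp [Fintype.linearCombination_apply, Pi.single_apply]⟩
    obtain ⟨w, hw, rfl⟩ := convexHull_min hsub ((convex_stdSimplex ℝ ι).linear_image _) hx
    exact ⟨w, hw.1, hw.2, rfl⟩
  · rintro ⟨w, hw, hw1, rfl⟩
    exact (convex_convexHull ℝ _).sum_mem (fun i _ => hw i) hw1
      fun i _ => subset_convexHull ℝ _ ⟨i, rfl⟩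

/-- The part of a polytope in a half-space is spanned by the vertices in the half-space and the
points where segments between two vertices cross the bounding hyperplane. -/
theorem exists_truncation {ι : Type*} [Fintype ι] (p : ι → E d) (u : E d) (c : ℝ)
    (hne : (convexHull ℝ (Set.range p) ∩ halfSpace u c).Nonempty) :
    ∃ q : ι × ι → E d, (∀ a, q a ∈ convexHull ℝ (Set.range p) ∩ halfSpace u c) ∧
      convexHull ℝ (Set.range p) ∩ halfSpace u c ⊆ convexHull ℝ (Set.range q) := by
  classical
  obtain ⟨z₀, hz₀⟩ := hne
  set l : ι → ℝ := fun i => inner ℝ u (p i) - c with hl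
  -- An inside–outside pair gives the crossing point, an inside–inside pair its first vertex, and
  -- the remaining pairs the dummy `z₀`.
  set q : ι × ι → E d := fun a => if 0 ≤ l a.1 then
    (if l a.2 < 0 then (l a.1 - l a.2)⁻¹ • ((-l a.2) • p a.1 + l a.1 • p a.2) else p a.1)
    else z₀ with hq
  have hpm : ∀ i, p i ∈ convexHull ℝ (Set.range p) := fun i => subset_convexHull ℝ _ ⟨i, rfl⟩
  refine ⟨q, ?_, ?_⟩
  · rintro ⟨i, j⟩
    simp only [hq]
    split_ifs with h1 h2
    · have hpos : 0 < l i - l j := by linarith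
      constructor
      · rw [smul_add, smul_smul, smul_smul]
        refine convex_convexHull ℝ _ (hpm i) (hpm j) ?_ ?_ ?_
        · exact mul_nonneg (inv_nonneg.2 hpos.le) (by linarith)
        · exact mul_nonneg (inv_nonneg.2 hpos.le) h1
        · rw [← mul_add, inv_mul_eq_one₀ hpos.ne']
          ring
      · rw [mem_halfSpace, inner_smul_right, inner_add_right, inner_smul_right, inner_smul_right]
        refine le_of_eq ?_
        rw [eq_inv_mul_iff_mul_eq₀ hpos.ne']
        simp only [hl]
        ring
    · exact ⟨hpm i, mem_halfSpace.2 (sub_nonneg.1 h1)⟩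
    · exact hz₀
  · rintro z ⟨hz, hzc⟩
    obtain ⟨w, hw, hw1, rfl⟩ := mem_convexHull_range_iff.1 hz
    set a : ι → ℝ := fun i => if 0 ≤ l i then 1 else 0 with ha
    set b : ι → ℝ := fun i => if l i < 0 then 1 else 0 with hb
    have hab : ∀ i, a i + b i = 1 := fun i => by
      simp only [ha, hb]
      by_cases h : 0 ≤ l i
      · simp [h, not_lt.2 h]
      · simp [h, not_le.1 h]
    have ha0 : ∀ i, 0 ≤ a i := fun i => by simp only [ha]; split_ifs <;> norm_num
    have hb0 : ∀ i, 0 ≤ b i := fun i => by simp only [hb]; split_ifs <;> norm_num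
    have hal : ∀ i, 0 ≤ a i * l i := fun i => by
      simp only [ha]; split_ifs with h <;> simp [h]
    have hbl : ∀ i, 0 ≤ -(b i * l i) := fun i => by
      simp only [hb]; split_ifs with h
      · linarith
      · simp
    set A := ∑ i, w i * (a i * l i) with hA
    set N := ∑ i, w i * (-(b i * l i)) with hN
    have hN0 : 0 ≤ N := Finset.sum_nonneg fun i _ => mul_nonneg (hw i) (hbl i)
    have hAN : N ≤ A := by
      have h1 : A - N = ∑ i, w i * l i := by
        rw [hA, hN, ← Finset.sum_sub_distrib]
        refine Finset.sum_congr rfl fun i _ => ?_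
        linear_combination (w i * l i) * hab i
      have h2 : ∑ i, w i * l i = inner ℝ u (∑ i, w i • p i) - c := by
        simp only [hl, mul_sub, Finset.sum_sub_distrib, ← Finset.sum_mul, hw1, inner_sum,
          inner_smul_right, one_mul]
      rw [mem_halfSpace] at hzc
      linarith
    have hqij : ∀ i j, (a i * b j * (l i - l j)) • q (i, j) =
        (a i * (-(b j * l j))) • p i + (b j * (a i * l i)) • p j := fun i j => by
      by_cases h1 : 0 ≤ l i
      · by_cases h2 : l j < 0
        · have hpos : 0 < l i - l j := by linarith
          simp only [hq, ha, hb, h1, h2, if_true]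
          rw [smul_smul, one_mul, one_mul, mul_inv_cancel₀ hpos.ne']
          module
        · simp [hb, h2]
      · simp [ha, h1]
    have hqii : ∀ i, a i • q (i, i) = a i • p i := fun i => by
      by_cases h1 : 0 ≤ l i
      · simp [hq, h1]
      · simp [ha, h1]
    have hsum0 : ∑ i, a i * w i + ∑ i, b i * w i = 1 := by
      rw [← Finset.sum_add_distrib, ← hw1]
      exact Finset.sum_congr rfl fun i _ => by rw [← add_mul, hab, one_mul]
    have hpsum : ∑ i, (a i * w i) • p i + ∑ i, (b i * w i) • p i = ∑ i, w i • p i := by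
      rw [← Finset.sum_add_distrib]
      exact Finset.sum_congr rfl fun i _ => by rw [← add_smul, ← add_mul, hab, one_mul]
    rcases (hN0.trans hAN).eq_or_lt with hA0 | hA0
    · have hNz : ∑ i, w i * (-(b i * l i)) = 0 := le_antisymm (by linarith) hN0
      have h1 : ∀ i, b i * w i = 0 := fun i => by
        have h2 := (Finset.sum_eq_zero_iff_of_nonneg
          (fun i _ => mul_nonneg (hw i) (hbl i))).1 hNz i (Finset.mem_univ i)
        by_cases h3 : l i < 0
        · simp only [hb, h3, if_true, one_mul] at h2 ⊢
          exact (mul_eq_zero.1 h2).resolve_right (by linarith)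
        · simp [hb, h3]
      simp only [h1, Finset.sum_const_zero, zero_smul, add_zero] at hsum0 hpsum
      rw [← hpsum]
      have h4 : ∀ i, (a i * w i) • p i = (a i * w i) • q (i, i) := fun i => by
        rw [mul_comm, mul_smul, mul_smul, hqii]
      simp_rw [h4]
      exact (convex_convexHull ℝ _).sum_mem (fun i _ => mul_nonneg (ha0 i) (hw i)) hsum0
        fun i _ => subset_convexHull ℝ _ ⟨_, rfl⟩
    -- `A` is the total weighted excess of the inside vertices and `N ≤ A` the total deficit of the
    -- outside ones. Each outside vertex is paired with the inside ones in proportion to their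
    -- excess. This uses a fraction `N/A` of each inside weight, and the rest stays on the diagonal.
    · set W : ι × ι → ℝ := fun e => w e.1 * w e.2 / A * (a e.1 * b e.2 * (l e.1 - l e.2)) +
        (if e.2 = e.1 then (1 - N / A) * w e.1 * a e.1 else 0) with hW
      have hNA : N / A ≤ 1 := (div_le_one hA0).2 hAN
      refine mem_convexHull_range_iff.2 ⟨W, ?_, ?_, ?_⟩
      · rintro ⟨i, j⟩
        refine add_nonneg (mul_nonneg (div_nonneg (mul_nonneg (hw i) (hw j)) hA0.le) ?_) ?_
        · have h1 := mul_nonneg (hb0 j) (hal i)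
          have h2 := mul_nonneg (ha0 i) (hbl j)
          simp only
          linarith
        · simp only
          split_ifs
          · exact mul_nonneg (mul_nonneg (sub_nonneg.2 hNA) (hw i)) (ha0 i)
          · exact le_rfl
      · rw [Fintype.sum_prod_type]
        have h1 : ∀ i, ∑ j, W (i, j) = (N / A) * (a i * w i) +
            (w i * (a i * l i)) / A * ∑ j, b j * w j + (1 - N / A) * (a i * w i) := fun i => by
          simp only [hW, Finset.sum_add_distrib, Finset.sum_ite_eq', Finset.mem_univ, if_true]
          congr 1
          · rw [hN, Finset.sum_div, Finset.sum_mul, Finset.mul_sum, ← Finset.sum_add_distrib]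
            refine Finset.sum_congr rfl fun j _ => ?_
            ring
          · ring
        simp only [h1, Finset.sum_add_distrib, ← Finset.mul_sum, ← Finset.sum_mul,
          ← Finset.sum_div]
        rw [← hA, div_self hA0.ne']
        linear_combination hsum0
      · rw [Fintype.sum_prod_type]
        have h0 : ∀ i j, W (i, j) • q (i, j) =
            ((w j * (-(b j * l j))) * ((1 / A) * (a i * w i))) • p i +
              ((w i * (a i * l i)) * (1 / A)) • (b j * w j) • p j +
              (if j = i then ((1 - N / A) * (a i * w i)) • p i else 0) := fun i j => by
          simp only [hW, add_smul]
          congr 1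
          · rw [mul_smul, hqij]
            module
          · split_ifs with h
            · subst h
              rw [mul_smul, hqii]
              module
            · simp
        have h1 : ∀ i, ∑ j, W (i, j) • q (i, j) = (N / A) • ((a i * w i) • p i) +
            ((w i * (a i * l i)) * (1 / A)) • (∑ j, (b j * w j) • p j) +
            (1 - N / A) • (a i * w i) • p i := fun i => by
          simp only [h0, Finset.sum_add_distrib, Finset.sum_ite_eq', Finset.mem_univ, if_true,
            ← Finset.sum_smul, ← Finset.sum_mul, ← Finset.smul_sum, ← hN]
          module
        simp only [h1, Finset.sum_add_distrib, ← Finset.smul_sum, ← Finset.sum_smul,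
          ← Finset.sum_mul, ← hA]
        rw [mul_one_div_cancel hA0.ne', ← hpsum]
        module

/-- **Carathéodory's theorem** with a fixed number of points. -/
theorem exists_simplex_of_mem_convexHull {ι : Type*} {q : ι → E d} {z : E d}
    (hz : z ∈ convexHull ℝ (Set.range q)) :
    ∃ f : Fin (d + 1) → ι, z ∈ convexHull ℝ (Set.range (q ∘ f)) := by
  obtain ⟨κ, _, y, w, hy, hind, hw, hw1, rfl⟩ := eq_pos_convex_span_of_mem_convexHull hz
  have hcard : Fintype.card κ ≤ d + 1 := by
    have h1 := hind.card_le_finrank_succ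
    have h2 := Submodule.finrank_le (vectorSpan ℝ (Set.range y))
    rw [finrank_euclideanSpace_fin] at h2
    omega
  have hκ : Nonempty κ := by
    by_contra h
    rw [not_nonempty_iff] at h
    simp at hw1
  choose g hg using fun k => hy ⟨k, rfl⟩
  obtain ⟨e⟩ : Nonempty (κ ↪ Fin (d + 1)) :=
    Function.Embedding.nonempty_of_card_le (by simpa using hcard)
  refine ⟨g ∘ Function.invFun e, ?_⟩
  refine (convex_convexHull ℝ _).sum_mem (fun i _ => (hw i).le) hw1 fun k _ => ?_
  refine subset_convexHull ℝ _ ⟨e k, ?_⟩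
  simp [Function.leftInverse_invFun e.injective k, hg]

/-! ### Volume of the wet part in simplices and caps. -/

theorem volume_box (a b : Fin d → ℝ) (hab : ∀ k, a k ≤ b k) :
    volume.real {x : E d | ∀ k, a k ≤ x k ∧ x k ≤ b k} = ∏ k, (b k - a k) := by
  have h : {x : E d | ∀ k, a k ≤ x k ∧ x k ≤ b k} = WithLp.ofLp ⁻¹' Set.Icc a b := by
    ext x
    exact ⟨fun h => ⟨fun k => (h k).1, fun k => (h k).2⟩, fun h k => ⟨h.1 k, h.2 k⟩⟩
  rw [h, Measure.real, (PiLp.volume_preserving_ofLp (Fin d)).measure_preimage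
    measurableSet_Icc.nullMeasurableSet, Real.volume_Icc_pi_toReal hab]

/-- The part of the unit cube below a hyperbolic surface. -/
def hyperbolicCube (d : ℕ) (ε : ℝ) : Set (E d) :=
  {x | (∀ k, 0 ≤ x k ∧ x k ≤ 1) ∧ ∏ k, x k ≤ ε}

theorem isCompact_hyperbolicCube (d : ℕ) (ε : ℝ) : IsCompact (hyperbolicCube d ε) := by
  have h : hyperbolicCube d ε =
      ((EuclideanSpace.equiv (Fin d) ℝ) ⁻¹' Set.Icc (fun _ => (0 : ℝ)) (fun _ => 1)) ∩
        {x : E d | ∏ k, x k ≤ ε} := by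
    ext x
    constructor
    · rintro ⟨h1, h2⟩
      exact ⟨⟨fun k => (h1 k).1, fun k => (h1 k).2⟩, h2⟩
    · rintro ⟨h1, h2⟩
      exact ⟨fun k => ⟨h1.1 k, h1.2 k⟩, h2⟩
  rw [h]
  refine IsCompact.inter_right ?_ (isClosed_le (by fun_prop) continuous_const)
  exact (EuclideanSpace.equiv (Fin d) ℝ).toHomeomorph.isCompact_preimage.2 isCompact_Icc

/-- Markov's inequality for `∏ x_k^(-a)` with `a = 1 - 1/L`: each factor integrates to `L` over
`(0,1]`, and the product is at least `ε^(-a)` on the region, up to the null coordinate hyperplanes.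
-/
theorem volume_hyperbolicCube_le {ε L : ℝ} (hε : 0 < ε) (hL : 1 ≤ L) :
    volume.real (hyperbolicCube d ε) ≤ ε ^ (1 - 1 / L) * L ^ d := by
  have hL0 : 0 < L := by linarith
  set a : ℝ := 1 - 1 / L with ha
  have ha0 : 0 ≤ a := by
    have : 1 / L ≤ 1 := (div_le_one hL0).2 hL
    linarith
  have ha1 : -1 < -a := by
    have : 0 < 1 / L := by positivity
    linarith
  set f : ℝ → ℝ := (Set.Ioc (0 : ℝ) 1).indicator fun x => x ^ (-a) with hf
  have hfint : Integrable f := by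
    rw [hf, integrable_indicator_iff measurableSet_Ioc]
    exact (intervalIntegrable_iff_integrableOn_Ioc_of_le zero_le_one).1
      (intervalIntegral.intervalIntegrable_rpow' ha1)
  have hfval : ∫ x, f x = L := by
    rw [hf, integral_indicator measurableSet_Ioc, ← intervalIntegral.integral_of_le zero_le_one,
      integral_rpow (Or.inl ha1)]
    have : -a + 1 = 1 / L := by rw [ha]; ring
    rw [this, Real.zero_rpow (by positivity), Real.one_rpow]
    field_simp
    ring
  have hf0 : ∀ x, 0 ≤ f x := fun x => by
    refine Set.indicator_nonneg (fun x hx => ?_) x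
    exact Real.rpow_nonneg hx.1.le _
  set S : Set (Fin d → ℝ) := {x | (∀ k, 0 < x k ∧ x k ≤ 1) ∧ ∏ k, x k ≤ ε} with hS
  have hprod : Integrable (fun x : Fin d → ℝ => ∏ k, f (x k)) :=
    Integrable.fintype_prod fun _ => hfint
  have hmarkov := mul_meas_ge_le_integral_of_nonneg (μ := (volume : Measure (Fin d → ℝ)))
    (f := fun x => ∏ k, f (x k))
    (Filter.Eventually.of_forall fun x => Finset.prod_nonneg fun k _ => hf0 _) hprod (ε ^ (-a))
  rw [integral_fintype_prod_volume_eq_prod (fun _ : Fin d => f)] at hmarkov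
  simp only [hfval, Finset.prod_const, Finset.card_univ, Fintype.card_fin] at hmarkov
  have hSsub : S ⊆ {x | ε ^ (-a) ≤ ∏ k, f (x k)} := by
    rintro x ⟨hx, hxε⟩
    have h1 : ∏ k, f (x k) = (∏ k, x k) ^ (-a) := by
      rw [← Real.finsetProd_rpow _ _ fun k _ => (hx k).1.le]
      refine Finset.prod_congr rfl fun k _ => ?_
      rw [hf, Set.indicator_of_mem (show x k ∈ Set.Ioc (0 : ℝ) 1 from hx k)]
    change ε ^ (-a) ≤ ∏ k, f (x k)
    rw [h1]
    exact Real.rpow_le_rpow_of_nonpos (Finset.prod_pos fun k _ => (hx k).1) hxε (by linarith)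
  have hae : ∀ᵐ x : Fin d → ℝ, ∀ k, x k ≠ 0 := by
    rw [ae_all_iff]
    intro k
    have h := (Measure.quasiMeasurePreserving_eval (fun _ : Fin d => (volume : Measure ℝ)) k).ae
      (measure_eq_zero_iff_ae_notMem.1 (Real.volume_singleton (a := 0)))
    filter_upwards [h] with x hx
    simpa using hx
  have hle : volume.real (hyperbolicCube d ε) ≤
      volume.real {x : Fin d → ℝ | ε ^ (-a) ≤ ∏ k, f (x k)} := by
    have h1 : hyperbolicCube d ε = WithLp.ofLp ⁻¹'
        {x : Fin d → ℝ | (∀ k, 0 ≤ x k ∧ x k ≤ 1) ∧ ∏ k, x k ≤ ε} := rfl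
    have hm : MeasurableSet {x : Fin d → ℝ | (∀ k, 0 ≤ x k ∧ x k ≤ 1) ∧ ∏ k, x k ≤ ε} := by
      measurability
    rw [h1, Measure.real, (PiLp.volume_preserving_ofLp (Fin d)).measure_preimage
      hm.nullMeasurableSet]
    refine ENNReal.toReal_mono ?_ (measure_mono_ae ?_)
    · have h2 := Integrable.measure_ge_lt_top hprod (Real.rpow_pos_of_pos hε (-a))
      exact h2.ne
    · filter_upwards [hae] with x hx hxS
      exact hSsub ⟨fun k => ⟨(hxS.1 k).1.lt_of_ne' (hx k), (hxS.1 k).2⟩, hxS.2⟩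
  calc volume.real (hyperbolicCube d ε) ≤ _ := hle
    _ = ε ^ a * (ε ^ (-a) * volume.real {x : Fin d → ℝ | ε ^ (-a) ≤ ∏ k, f (x k)}) := by
        rw [← mul_assoc, ← Real.rpow_add hε]; simp
    _ ≤ ε ^ a * L ^ d := by gcongr

theorem volume_image_affine (A : E d →ₗ[ℝ] E d) (c : E d) (S : Set (E d)) :
    volume.real ((fun x => c + A x) '' S) = |LinearMap.det A| * volume.real S := by
  have : (fun x => c + A x) '' S = (fun y => c + y) '' (A '' S) := by rw [Set.image_image]
  rw [this, Measure.real, Set.image_add_left, measure_preimage_add, Measure.addHaar_image_linearMap,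
    ENNReal.toReal_mul, ENNReal.toReal_ofReal (abs_nonneg _), Measure.real]

/-- The linear part of the affine chart of a simplex based at its vertex `i`. -/
def simplexMap (p : Fin (d + 1) → E d) (i : Fin (d + 1)) : E d →ₗ[ℝ] E d where
  toFun x := ∑ k, x k • (p (i.succAbove k) - p i)
  map_add' x y := by simp [add_smul, Finset.sum_add_distrib]
  map_smul' r x := by simp [mul_smul, Finset.smul_sum]

theorem simplexMap_mem_convexHull (p : Fin (d + 1) → E d) (i : Fin (d + 1)) {x : E d}
    (hx : ∀ k, 0 ≤ x k) (hx1 : ∑ k, x k ≤ 1) :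
    p i + simplexMap p i x ∈ convexHull ℝ (Set.range p) := by
  refine mem_convexHull_range_iff.2 ⟨fun j => Fin.insertNth (α := fun _ => ℝ) i (1 - ∑ k, x k)
    (fun k => x k) j, fun j => ?_, ?_, ?_⟩
  · refine Fin.succAboveCases i ?_ (fun k => ?_) j
    · simpa using hx1
    · simpa using hx k
  · rw [Fin.sum_univ_succAbove _ i]
    simp
  · rw [Fin.sum_univ_succAbove _ i]
    simp [simplexMap, smul_sub, Finset.sum_sub_distrib, ← Finset.sum_smul]
    module

/-- Basing the chart at a vertex of largest barycentric weight bounds every coordinate by the weight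
`1 - ∑ x_k` of that vertex. This leaves room for a box around `x`. -/
theorem exists_simplexMap_eq (p : Fin (d + 1) → E d) {z : E d}
    (hz : z ∈ convexHull ℝ (Set.range p)) :
    ∃ (i : Fin (d + 1)) (x : E d), z = p i + simplexMap p i x ∧ (∀ k, 0 ≤ x k) ∧
      ∀ k, x k ≤ 1 - ∑ k, x k := by
  obtain ⟨w, hw, hw1, rfl⟩ := mem_convexHull_range_iff.1 hz
  obtain ⟨i, -, hi⟩ := Finset.exists_max_image Finset.univ w ⟨0, Finset.mem_univ _⟩
  have h1 : w i = 1 - ∑ k, w (i.succAbove k) := by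
    rw [← hw1, Fin.sum_univ_succAbove _ i]; ring
  refine ⟨i, WithLp.toLp 2 fun k => w (i.succAbove k), ?_, fun k => hw _, fun k => ?_⟩
  · rw [Fin.sum_univ_succAbove _ i, h1]
    simp [simplexMap, smul_sub, Finset.sum_sub_distrib, ← Finset.sum_smul]
    module
  · simp only
    rw [← h1]
    exact hi _ (Finset.mem_univ _)

theorem det_simplexMap_le (hd : 0 < d) (p : Fin (d + 1) → E d) (i : Fin (d + 1)) :
    |LinearMap.det (simplexMap p i)| ≤
      (d : ℝ) ^ d * volume.real (convexHull ℝ (Set.range p)) := by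
  have hd' : (0 : ℝ) < d := by exact_mod_cast hd
  have h1 := volume_image_affine (simplexMap p i) (p i)
    {x : E d | ∀ k, (fun _ => (0 : ℝ)) k ≤ x k ∧ x k ≤ (fun _ => 1 / (d : ℝ)) k}
  rw [volume_box _ _ fun k => by positivity] at h1
  have h2 := volume_real_mono ((Set.finite_range p).isCompact_convexHull ℝ)
    (show (fun x => p i + simplexMap p i x) '' {x : E d | ∀ k, (fun _ => (0 : ℝ)) k ≤ x k ∧
      x k ≤ (fun _ => 1 / (d : ℝ)) k} ⊆ convexHull ℝ (Set.range p) by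
      rintro _ ⟨x, hx, rfl⟩
      refine simplexMap_mem_convexHull p i (fun k => (hx k).1) ?_
      calc ∑ k, x k ≤ ∑ k : Fin d, 1 / (d : ℝ) := Finset.sum_le_sum fun k _ => (hx k).2
        _ = 1 := by simp [hd'.ne'])
  rw [h1] at h2
  simp only [sub_zero, Finset.prod_const, Finset.card_univ, Fintype.card_fin] at h2
  rw [one_div, inv_pow, ← div_eq_mul_inv, div_le_iff₀ (by positivity)] at h2
  linarith

/-- The box centred at `x` with half-sides `x_k/d` stays in the chart of the simplex. By symmetry
its image lies in the Macbeath region, whose volume is at most `2v`. -/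
theorem det_mul_prod_le_v (hd : 0 < d) (hK : IsCompact K) (hc : Convex ℝ K)
    {p : Fin (d + 1) → E d} (hp : ∀ i, p i ∈ K) (i : Fin (d + 1)) {x : E d}
    (hx : ∀ k, 0 ≤ x k) (hx1 : ∀ k, x k ≤ 1 - ∑ k, x k) :
    |LinearMap.det (simplexMap p i)| * ∏ k, x k ≤
      2 * ((d : ℝ) / 2) ^ d * v K (p i + simplexMap p i x) := by
  have hd' : (0 : ℝ) < d := by exact_mod_cast hd
  have hsub : convexHull ℝ (Set.range p) ⊆ K :=
    convexHull_min (by rintro _ ⟨i, rfl⟩; exact hp i) hc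
  set B : Set (E d) := {y : E d | ∀ k, (fun k => x k - x k / d) k ≤ y k ∧
    y k ≤ (fun k => x k + x k / d) k} with hB
  have hmem : ∀ y ∈ B, p i + simplexMap p i y ∈ K := by
    intro y hy
    refine hsub (simplexMap_mem_convexHull p i (fun k => le_trans ?_ (hy k).1) ?_)
    · simp only [sub_nonneg]
      exact div_le_self (hx k) (by exact_mod_cast hd)
    · calc ∑ k, y k ≤ ∑ k, (x k + x k / d) := Finset.sum_le_sum fun k _ => (hy k).2
        _ ≤ ∑ k, x k + ∑ k : Fin d, (1 - ∑ k, x k) / d := by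
            rw [Finset.sum_add_distrib]
            gcongr with k _
            exact hx1 k
        _ = 1 := by simp; field_simp; ring
  have h1 : (fun y => p i + simplexMap p i y) '' B ⊆
      macbeath K (p i + simplexMap p i x) 1 := by
    rintro _ ⟨y, hy, rfl⟩
    refine mem_macbeath_one.2 ⟨hmem y hy, ?_⟩
    have hy' : (2 : ℝ) • x - y ∈ B := fun k => by
      have := hy k
      simp only [PiLp.sub_apply, PiLp.smul_apply, smul_eq_mul] at this ⊢
      constructor <;> linarith
    convert hmem _ hy' using 1
    rw [map_sub, map_smul]
    module
  have h2 := volume_real_mono (isCompact_macbeath_one hK _) h1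
  rw [volume_image_affine, hB, volume_box _ _ fun k => by
    have := div_nonneg (hx k) hd'.le
    simp only; linarith] at h2
  have h3 := h2.trans (volume_macbeath_one_le hd hK _)
  have h4 : ∏ k, (x k + x k / d - (x k - x k / d)) = (2 / (d : ℝ)) ^ d * ∏ k, x k := by
    have : ∀ k, x k + x k / d - (x k - x k / d) = 2 / (d : ℝ) * x k := fun k => by ring
    simp only [this, Finset.prod_mul_distrib, Finset.prod_const, Finset.card_univ,
      Fintype.card_fin]
  rw [h4] at h3
  have h5 : ((d : ℝ) / 2) ^ d * (2 / (d : ℝ)) ^ d = 1 := by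
    rw [← mul_pow]; field_simp; simp
  calc |LinearMap.det (simplexMap p i)| * ∏ k, x k
      = (((d : ℝ) / 2) ^ d * (2 / (d : ℝ)) ^ d) *
        (|LinearMap.det (simplexMap p i)| * ∏ k, x k) := by rw [h5, one_mul]
    _ = ((d : ℝ) / 2) ^ d *
        (|LinearMap.det (simplexMap p i)| * ((2 / (d : ℝ)) ^ d * ∏ k, x k)) := by ring
    _ ≤ ((d : ℝ) / 2) ^ d * (2 * v K (p i + simplexMap p i x)) := by gcongr
    _ = _ := by ring

/-- The wet part of a convex body takes little volume of any simplex inscribed in the body. -/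
theorem volume_simplex_inter_wetPart_le (hd : 0 < d) (hK : IsCompact K) (hc : Convex ℝ K)
    {p : Fin (d + 1) → E d} (hp : ∀ i, p i ∈ K) {τ L : ℝ} (hτ : 0 < τ) (hL : 1 ≤ L)
    (hW : 2 ^ d * volume.real (convexHull ℝ (Set.range p)) ≤ τ * Real.exp L) :
    volume.real (convexHull ℝ (Set.range p) ∩ wetPart K τ) ≤
      ((d + 1) * (2 * (d / 2) ^ d) * Real.exp 1) * (τ * L ^ d) := by
  have hd' : (0 : ℝ) < d := by exact_mod_cast hd
  have hL0 : 0 < L := by linarith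
  set c : ℝ := 2 * ((d : ℝ) / 2) ^ d with hcdef
  have hc0 : 0 < c := by positivity
  let δ : Fin (d + 1) → ℝ := fun i => |LinearMap.det (simplexMap p i)|
  let S : Fin (d + 1) → Set (E d) := fun i =>
    (fun x => p i + simplexMap p i x) '' {x | (∀ k, 0 ≤ x k ∧ x k ≤ 1) ∧ δ i * ∏ k, x k ≤ c * τ}
  have hcov : convexHull ℝ (Set.range p) ∩ wetPart K τ ⊆ ⋃ i ∈ Finset.univ, S i := by
    rintro z ⟨hz, hzw⟩
    obtain ⟨i, x, rfl, hx, hx1⟩ := exists_simplexMap_eq p hz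
    refine Set.mem_iUnion₂.2 ⟨i, Finset.mem_univ _, x, ⟨fun k => ⟨hx k, ?_⟩, ?_⟩, rfl⟩
    · have := Finset.sum_nonneg fun k (_ : k ∈ Finset.univ) => hx k
      linarith [hx1 k]
    · refine (det_mul_prod_le_v hd hK hc hp i hx hx1).trans ?_
      gcongr
      exact hzw.2
  have hS : ∀ i, volume (S i) ≠ ⊤ ∧ volume.real (S i) ≤ c * τ * (Real.exp 1 * L ^ d) := by
    intro i
    have hSv : volume (S i) = ENNReal.ofReal (δ i) *
        volume {x : E d | (∀ k, 0 ≤ x k ∧ x k ≤ 1) ∧ δ i * ∏ k, x k ≤ c * τ} := by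
      simp only [S]
      rw [← Set.image_image (fun y => p i + y) (simplexMap p i), Set.image_add_left,
        measure_preimage_add, Measure.addHaar_image_linearMap]
    have hSr := volume_image_affine (simplexMap p i) (p i)
      {x : E d | (∀ k, 0 ≤ x k ∧ x k ≤ 1) ∧ δ i * ∏ k, x k ≤ c * τ}
    rcases (abs_nonneg (LinearMap.det (simplexMap p i))).eq_or_lt with h0 | h0
    · have hδ : δ i = 0 := h0.symm
      constructor
      · rw [hSv, hδ]; simp
      · rw [hSr, ← h0, zero_mul]; positivity
    · have hδ : 0 < δ i := h0
      have hset : {x : E d | (∀ k, 0 ≤ x k ∧ x k ≤ 1) ∧ δ i * ∏ k, x k ≤ c * τ} =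
          hyperbolicCube d (c * τ / δ i) := by
        ext x
        simp only [hyperbolicCube, Set.mem_ofPred_eq, le_div_iff₀' hδ]
      constructor
      · rw [hSv, hset]
        exact ENNReal.mul_ne_top ENNReal.ofReal_ne_top
          (isCompact_hyperbolicCube d _).measure_lt_top.ne
      · rw [hSr, hset]
        have hε : 0 < c * τ / δ i := by positivity
        have h1 := volume_hyperbolicCube_le (d := d) hε hL
        have h2 : δ i ≤ c * τ * Real.exp L := by
          refine (det_simplexMap_le hd p i).trans ?_
          have h3 : (d : ℝ) ^ d = ((d : ℝ) / 2) ^ d * 2 ^ d := by rw [← mul_pow]; field_simp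
          have hV : 0 ≤ volume.real (convexHull ℝ (Set.range p)) := measureReal_nonneg
          calc (d : ℝ) ^ d * volume.real (convexHull ℝ (Set.range p))
              = ((d : ℝ) / 2) ^ d * (2 ^ d * volume.real (convexHull ℝ (Set.range p))) := by
                rw [h3]; ring
            _ ≤ ((d : ℝ) / 2) ^ d * (τ * Real.exp L) := by gcongr
            _ ≤ 2 * (((d : ℝ) / 2) ^ d * (τ * Real.exp L)) :=
                le_mul_of_one_le_left (by positivity) one_le_two
            _ = _ := by rw [hcdef]; ring
        -- The choice of `L` makes `δ i ≤ cτ e^L`, so the loss `ε^(-1/L)` in the hyperbolic bound is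
        -- at most `e`.
        have h4 : (c * τ / δ i) ^ (1 - 1 / L) ≤ c * τ / δ i * Real.exp 1 := by
          rw [sub_eq_add_neg, Real.rpow_add hε, Real.rpow_one]
          gcongr
          rw [Real.rpow_neg hε.le, ← Real.inv_rpow hε.le, inv_div]
          calc (δ i / (c * τ)) ^ (1 / L) ≤ (Real.exp L) ^ (1 / L) := by
                refine Real.rpow_le_rpow (by positivity) ?_ (by positivity)
                rw [div_le_iff₀ (by positivity)]
                linarith
            _ = Real.exp 1 := by
                rw [← Real.exp_mul, mul_one_div_cancel hL0.ne']
        calc δ i * volume.real (hyperbolicCube d (c * τ / δ i))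
            ≤ δ i * ((c * τ / δ i * Real.exp 1) * L ^ d) := by
              gcongr
              exact h1.trans (by gcongr)
          _ = _ := by field_simp
  have hfin : volume (⋃ i ∈ Finset.univ, S i) ≠ ⊤ :=
    ((measure_biUnion_lt_top (Finset.finite_toSet _)) fun i _ => (hS i).1.lt_top).ne
  calc volume.real (convexHull ℝ (Set.range p) ∩ wetPart K τ)
      ≤ volume.real (⋃ i ∈ Finset.univ, S i) := measureReal_mono hcov hfin
    _ ≤ ∑ i, volume.real (S i) := measureReal_biUnion_finset_le _ _
    _ ≤ ∑ _i : Fin (d + 1), c * τ * (Real.exp 1 * L ^ d) :=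
        Finset.sum_le_sum fun i _ => (hS i).2
    _ = _ := by simp; ring

theorem IsPolytope.isCompact {P : Set (E d)} (hP : IsPolytope P) : IsCompact P := by
  obtain ⟨V, rfl⟩ := hP
  exact (Finset.finite_toSet V).isCompact_convexHull ℝ

theorem IsPolytope.convex {P : Set (E d)} (hP : IsPolytope P) : Convex ℝ P := by
  obtain ⟨V, rfl⟩ := hP
  exact convex_convexHull ℝ _

theorem one_le_numFlags {P : Set (E d)} (hP : IsPolytope P) (hint : (interior P).Nonempty) :
    1 ≤ numFlags P := by
  obtain ⟨q, -, hcov⟩ := exists_simplex_cover hP hint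
  obtain ⟨x, hx⟩ := hint
  obtain ⟨f, hf, -⟩ := Set.mem_iUnion₂.1 (hcov (interior_subset hx))
  exact (Set.ncard_pos (finite_flags hP)).2 ⟨f, hf⟩

theorem volume_biUnion_le_card_mul {ι : Type*} (s : Finset ι) (A : ι → Set (E d)) {B : Set (E d)}
    (hB : IsCompact B) (hA : ∀ i ∈ s, A i ⊆ B) {r : ℝ} (hr : ∀ i ∈ s, volume.real (A i) ≤ r)
    {S : Set (E d)} (hS : S ⊆ ⋃ i ∈ s, A i) : volume.real S ≤ s.card * r := by
  have hfin : volume (⋃ i ∈ s, A i) ≠ ⊤ :=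
    ((measure_mono (Set.iUnion₂_subset hA)).trans_lt hB.measure_lt_top).ne
  calc volume.real S ≤ volume.real (⋃ i ∈ s, A i) := measureReal_mono hS hfin
    _ ≤ ∑ i ∈ s, volume.real (A i) := measureReal_biUnion_finset_le _ _
    _ ≤ ∑ _i ∈ s, r := Finset.sum_le_sum hr
    _ = s.card * r := by simp

/-- The factor in the bound for the volume of the wet part inside a cap, for each flag. -/
noncomputable def wetFactor (d : ℕ) : ℝ :=
  (((d + 1) * (d + 1)) ^ (d + 1) : ℕ) * ((d + 1) * (2 * (d / 2) ^ d) * Real.exp 1)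

theorem wetFactor_nonneg (d : ℕ) : 0 ≤ wetFactor d := by
  unfold wetFactor; positivity

/-- By Carathéodory, the truncated simplex is covered by the `((d+1)^2)^(d+1)` simplices on tuples
of spanning points. These lie inside the cap, so `L` need only be a logarithm of `V(cap)/τ` and not
of `V(K)/τ`; hence `ln ln η` rather than `ln η`. -/
theorem volume_truncated_simplex_inter_wetPart_le (hd : 0 < d) (hK : IsCompact K)
    (hc : Convex ℝ K) {p : Fin (d + 1) → E d} (hp : ∀ i, p i ∈ K) {u : E d} {t τ L : ℝ}
    (hτ : 0 < τ) (hL : 1 ≤ L) (hW : 2 ^ d * volume.real (cap K u t) ≤ τ * Real.exp L) :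
    volume.real (convexHull ℝ (Set.range p) ∩ halfSpace u (supportFn K u - t) ∩ wetPart K τ) ≤
      wetFactor d * (τ * L ^ d) := by
  have hL0 : 0 < L := by linarith
  rcases (convexHull ℝ (Set.range p) ∩ halfSpace u (supportFn K u - t)).eq_empty_or_nonempty
    with h0 | hne
  · rw [h0, Set.empty_inter, measureReal_empty]
    exact mul_nonneg (wetFactor_nonneg d) (by positivity)
  have hsub : convexHull ℝ (Set.range p) ⊆ K :=
    convexHull_min (by rintro _ ⟨i, rfl⟩; exact hp i) hc
  obtain ⟨q, hq, hcov⟩ := exists_truncation p u _ hne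
  have hqcap : ∀ a, q a ∈ cap K u t := fun a => ⟨hsub (hq a).1, (hq a).2⟩
  have hsimplex : ∀ g : Fin (d + 1) → Fin (d + 1) × Fin (d + 1),
      volume.real (convexHull ℝ (Set.range (q ∘ g)) ∩ wetPart K τ) ≤
        ((d + 1) * (2 * (d / 2) ^ d) * Real.exp 1) * (τ * L ^ d) := fun g => by
    refine volume_simplex_inter_wetPart_le hd hK hc (fun i => (hqcap (g i)).1) hτ hL
      (le_trans ?_ hW)
    refine mul_le_mul_of_nonneg_left (volume_real_mono (isCompact_cap hK u t)
      (convexHull_min ?_ (convex_cap hc u t))) (by positivity)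
    rintro _ ⟨i, rfl⟩
    exact hqcap _
  have h := volume_biUnion_le_card_mul Finset.univ
    (fun g : Fin (d + 1) → Fin (d + 1) × Fin (d + 1) =>
      convexHull ℝ (Set.range (q ∘ g)) ∩ wetPart K τ) hK
    (fun g _ z hz => hz.2.1) (fun g _ => hsimplex g)
    (S := convexHull ℝ (Set.range p) ∩ halfSpace u (supportFn K u - t) ∩ wetPart K τ) (by
      rintro z ⟨hz, hzw⟩
      obtain ⟨g, hg⟩ := exists_simplex_of_mem_convexHull (hcov hz)
      exact Set.mem_iUnion₂.2 ⟨g, Finset.mem_univ _, hg, hzw⟩)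
  refine h.trans (le_of_eq ?_)
  simp only [Finset.card_univ, Fintype.card_fun, Fintype.card_prod, Fintype.card_fin, wetFactor]
  ring

theorem volume_cap_inter_wetPart_le (hd : 0 < d) {P : Set (E d)} (hP : IsPolytope P)
    (hint : (interior P).Nonempty) {u : E d} {t τ L : ℝ} (hτ : 0 < τ) (hL : 1 ≤ L)
    (hW : 2 ^ d * volume.real (cap P u t) ≤ τ * Real.exp L) :
    volume.real (cap P u t ∩ wetPart P τ) ≤ numFlags P * (wetFactor d * (τ * L ^ d)) := by
  obtain ⟨q, hqP, hcov⟩ := exists_simplex_cover hP hint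
  have hfin := finite_flags hP
  rw [numFlags, Set.ncard_eq_toFinset_card _ hfin]
  refine volume_biUnion_le_card_mul hfin.toFinset
    (fun f => convexHull ℝ (Set.range (q f)) ∩ halfSpace u (supportFn P u - t) ∩ wetPart P τ)
    hP.isCompact (fun f _ z hz => hz.2.1) (fun f hf => ?_) ?_
  · exact volume_truncated_simplex_inter_wetPart_le hd hP.isCompact hP.convex
      (hqP f (hfin.mem_toFinset.1 hf)) hτ hL hW
  · rintro z ⟨⟨hzP, hzu⟩, hzw⟩
    obtain ⟨f, hf, hzf⟩ := Set.mem_iUnion₂.1 (hcov hzP)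
    exact Set.mem_iUnion₂.2 ⟨f, hfin.mem_toFinset.2 hf, ⟨hzf, hzu⟩, hzw⟩

/-! ### Linking caps and counting neighbours. -/

/-- If two caps of volume at most `A` share a point `x` with `v x ≥ r`, then either is contained in
the enlargement of the other by this factor. -/
noncomputable def linkFactor (d : ℕ) (A r : ℝ) : ℝ := 1 + 2 ^ (d + 2) * (2 ^ d * A / (r / (2 * (d + 1)) ^ d))

/-- The doubled cap in direction `w` contains `M(x,1)`, so the packing lemma applies to it. Doubling
costs the inner factor `2^d` in `linkFactor`. -/
theorem cap_subset_of_mem_inter (hd : 0 < d) (hK : IsCompact K) (hc : Convex ℝ K) {u w x : E d}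
    {t r A b : ℝ} (hu : u ≠ 0) (hxu : x ∈ cap K u t) (hxw : x ∈ cap K w r) (hb : 0 < b)
    (hbx : b ≤ v K x) (hA : volume.real (cap K w r) ≤ A) :
    cap K w r ⊆ cap K u (linkFactor d A b * t) := by
  refine (cap_mono w (show r ≤ 2 * r by linarith [depth_nonneg hK hxw])).trans ?_
  refine subset_cap_of_macbeath_subset hK hu hxu (isCompact_cap hK w _) (convex_cap hc w _)
    Set.inter_subset_left (macbeath_one_subset_cap hK hxw) ?_ (by positivity) ?_
  · refine (volume_cap_mul_le hK hc w one_le_two).trans ?_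
    gcongr
  · rw [div_le_iff₀ (by positivity), mul_comm]
    exact hbx.trans (v_le_volume_macbeath_one hd hK hc x)

theorem cap_subset_trans (hK : IsCompact K) (hc : Convex ℝ K) {u w w' : E d} {t r r' l m : ℝ}
    (hr : 0 ≤ r) (hm : 1 ≤ m) (h : cap K w r ⊆ cap K u (l * t))
    (h' : cap K w' r' ⊆ cap K w (m * r)) :
    cap K w' r' ⊆ cap K u ((m * l) * t) :=
  h'.trans (cap_mul_subset_of_cap_subset hK hc hr hm h)

theorem one_le_six_mul_gam (hd : 0 < d) : 1 ≤ gam d * 6 := by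
  have h1 : (1 : ℝ) ≤ d := by exact_mod_cast hd
  have h2 : (1 : ℝ) ≤ (d : ℝ) ^ 3 := one_le_pow₀ h1
  have h3 : (1 : ℝ) ≤ 6 ^ d := one_le_pow₀ (by norm_num)
  have h4 := one_le_mul_of_one_le_of_one_le h2 h3
  unfold gam
  nlinarith

namespace CapSystem

variable {t : ℝ}

theorem normal_ne_zero (Q : CapSystem K t) (j : Fin Q.m) : Q.normal j ≠ 0 := fun h => by
  have := (Q.minimal j).1
  simp [h] at this

theorem v_point_bounds (hd : 0 < d) (hK : IsCompact K) (hc : Convex ℝ K) (ht : 0 < t)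
    (Q : CapSystem K t) (j : Fin Q.m) : t ≤ v K (Q.point j) ∧ v K (Q.point j) ≤ 2 ^ d * t :=
  v_bounds_of_mem_levelSurface hd hK hc ht (Q.saturated.1.1 ⟨j, rfl⟩)

theorem volume_bigCap_le (hd : 0 < d) (hK : IsCompact K) (hc : Convex ℝ K) (ht : 0 < t)
    (Q : CapSystem K t) (j : Fin Q.m) :
    volume.real (Q.bigCap (gam d) j) ≤ (gam d * 6) ^ d * (2 ^ d * t) := by
  unfold bigCap
  rw [← mul_assoc]
  refine (volume_cap_mul_le hK hc _ (one_le_six_mul_gam hd)).trans ?_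
  rw [(Q.minimal j).2.2]
  have := one_le_six_mul_gam hd
  gcongr
  exact (Q.v_point_bounds hd hK hc ht j).2

theorem smallCap_subset_bigCap (hd : 0 < d) (hK : IsCompact K) (Q : CapSystem K t) (j : Fin Q.m) :
    Q.smallCap j ⊆ Q.bigCap (gam d) j := by
  refine Set.inter_subset_right.trans (cap_mono _ ?_)
  have h1 := depth_nonneg hK (Q.minimal j).2.1
  have h2 := one_le_six_mul_gam hd
  nlinarith

theorem smallCap_subset_wetPart (hd : 0 < d) (hK : IsCompact K) (hc : Convex ℝ K) (ht : 0 < t)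
    (Q : CapSystem K t) (j : Fin Q.m) : Q.smallCap j ⊆ wetPart K (2 ^ d * t) := by
  rintro z ⟨-, hz⟩
  refine ⟨hz.1, (v_le (Q.normal_ne_zero j) hz.2).trans ?_⟩
  have h := (Q.minimal j).2.2
  rw [cap] at h
  rw [h]
  exact (Q.v_point_bounds hd hK hc ht j).2

theorem le_volume_smallCap (hd : 0 < d) (hK : IsCompact K) (hc : Convex ℝ K) (ht : 0 < t)
    (Q : CapSystem K t) (j : Fin Q.m) :
    t ≤ (2 * (4 * (d + 1)) ^ d) * volume.real (Q.smallCap j) :=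
  (Q.v_point_bounds hd hK hc ht j).1.trans (le_volume_macbeath_inter_cap hd hK hc (Q.minimal j))

theorem isCompact_smallCap (hK : IsCompact K) (Q : CapSystem K t) (j : Fin Q.m) :
    IsCompact (Q.smallCap j) :=
  (isCompact_macbeath hK _ _).inter (isCompact_cap hK _ _)

theorem convex_smallCap (hc : Convex ℝ K) (Q : CapSystem K t) (j : Fin Q.m) :
    Convex ℝ (Q.smallCap j) :=
  (convex_macbeath hc _ _).inter (convex_cap hc _ _)

theorem disjoint_smallCap (Q : CapSystem K t) {i j : Fin Q.m} (hij : i ≠ j) :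
    Disjoint (Q.smallCap i) (Q.smallCap j) :=
  (Q.saturated.1.2 ⟨i, rfl⟩ ⟨j, rfl⟩ (Q.point_injective.ne hij)).mono Set.inter_subset_left
    Set.inter_subset_left

theorem card_mul_le_volume (hd : 0 < d) (hK : IsCompact K) (hc : Convex ℝ K) (ht : 0 < t)
    (Q : CapSystem K t) (J : Finset (Fin Q.m)) {A : Set (E d)} (hA : volume A ≠ ⊤)
    (hJ : ∀ j ∈ J, Q.smallCap j ⊆ A) :
    J.card * t ≤ (2 * (4 * (d + 1)) ^ d) * volume.real A := by
  have h1 := measureReal_biUnion_finset (μ := volume) (s := J) (f := Q.smallCap)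
    (fun i _ j _ hij => Q.disjoint_smallCap hij)
    (fun j _ => (Q.isCompact_smallCap hK j).measurableSet)
    (fun j _ => (Q.isCompact_smallCap hK j).measure_lt_top.ne)
  calc (J.card : ℝ) * t = ∑ _j ∈ J, t := by simp
    _ ≤ ∑ j ∈ J, (2 * (4 * (d + 1)) ^ d) * volume.real (Q.smallCap j) :=
        Finset.sum_le_sum fun j _ => Q.le_volume_smallCap hd hK hc ht j
    _ = (2 * (4 * (d + 1)) ^ d) * volume.real (⋃ j ∈ J, Q.smallCap j) := by
        rw [h1, Finset.mul_sum]
    _ ≤ _ := by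
        gcongr
        exact Set.iUnion₂_subset hJ

end CapSystem

/-- The caps of a dependency chain have volume at most this multiple of `T`. -/
noncomputable def chainFactor (d : ℕ) : ℝ := (gam d * 6) ^ d * 2 ^ d + 2 ^ (d + 1) * (d * 6 ^ d)

theorem chainFactor_nonneg (hd : 0 < d) : 0 ≤ chainFactor d := by
  have := one_le_six_mul_gam hd
  unfold chainFactor
  positivity

namespace CellSystem

variable {P : Set (E d)} {η : ℝ} {Q : CapSystem P (T d η)}

/-- `K'_k` has interior points and lies in `S'_k`, because `v ≤ 2^d T ≤ T*` on it. It therefore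
cannot be covered by other cells only. -/
theorem sees_of_S'_subset (hd : 0 < d) (hK : IsCompact P) (hc : Convex ℝ P) (hT : 0 < T d η)
    (R : CellSystem P η Q) {i k : Fin Q.m} (h : R.S' k ⊆ R.L i) : R.Sees i k := by
  have hd1 : (1 : ℝ) ≤ d := by exact_mod_cast hd
  have hle : 2 ^ d * T d η ≤ Tstar d η := by
    unfold Tstar
    have : (2 : ℝ) ^ d ≤ d * 6 ^ d :=
      (pow_le_pow_left₀ (by norm_num) (by norm_num) d).trans
        (le_mul_of_one_le_left (by positivity) hd1)
    gcongr
  have hpos : 0 < volume.real (Q.smallCap k) :=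
    pos_of_mul_pos_right (hT.trans_le (Q.le_volume_smallCap hd hK hc hT k)) (by positivity)
  have hS' : Q.smallCap k ⊆ R.S' k := fun z hz => ⟨R.smallCap_subset k hz,
    (Q.smallCap_subset_wetPart hd hK hc hT k hz).1,
    (Q.smallCap_subset_wetPart hd hK hc hT k hz).2.trans hle⟩
  refine mem_of_interior_nonempty_of_subset_iUnion R.closed R.interior_disjoint
    (interior_nonempty_of_volume_real_pos (Q.convex_smallCap hc k) hpos) (R.smallCap_subset k)
    (J := {k | R.Sees i k}) ((hS'.trans h).trans ?_)
  exact Set.iUnion₂_mono fun l _ => Set.inter_subset_left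

theorem Sees.exists_link (hd : 0 < d) (hK : IsCompact P) (hc : Convex ℝ P) (hT : 0 < T d η)
    (hs : 0 < s d η) {R : CellSystem P η Q} {i k : Fin Q.m} (h : R.Sees i k) :
    ∃ (w : E d) (r : ℝ), 0 ≤ r ∧
      cap P w r ⊆ cap P (Q.normal i)
        (linkFactor d (chainFactor d * T d η) (s d η) * (gam d * (6 * Q.depth i))) ∧
      Q.bigCap (gam d) k ⊆ cap P w (linkFactor d (chainFactor d * T d η) (s d η) * r) ∧
      cap P w r ⊆ cap P (Q.normal k)
        (linkFactor d (chainFactor d * T d η) (s d η) * (gam d * (6 * Q.depth k))) ∧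
      Q.bigCap (gam d) i ⊆ cap P w (linkFactor d (chainFactor d * T d η) (s d η) * r) := by
  obtain ⟨a, ⟨ha, -, has⟩, b, ⟨hb, -, hbs⟩, hab⟩ := h
  have hTs : 0 ≤ Tstar d η := by unfold Tstar; positivity
  have hg := one_le_six_mul_gam hd
  obtain ⟨w, r, hw, haw, hbw, hvol⟩ := exists_cap_of_segment_disjoint hd hK hc hTs ha.2.1 hb.2.1 hab
  have hvol' : volume.real (cap P w r) ≤ chainFactor d * T d η := by
    refine hvol.trans ?_
    unfold Tstar chainFactor
    have : 0 ≤ (gam d * 6) ^ d * 2 ^ d * T d η := by positivity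
    linarith
  have hbig : ∀ j, volume.real (Q.bigCap (gam d) j) ≤ chainFactor d * T d η := fun j => by
    refine (Q.volume_bigCap_le hd hK hc hT j).trans ?_
    unfold chainFactor
    have : 0 ≤ (2 : ℝ) ^ (d + 1) * (d * 6 ^ d) * T d η := by positivity
    linarith
  have hai := R.subset_bigCap i ha
  have hbk := R.subset_bigCap k hb
  exact ⟨w, r, depth_nonneg hK haw,
    cap_subset_of_mem_inter hd hK hc (Q.normal_ne_zero i) hai haw hs has hvol',
    cap_subset_of_mem_inter hd hK hc hw hbw hbk hs hbs (hbig k),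
    cap_subset_of_mem_inter hd hK hc (Q.normal_ne_zero k) hbk hbw hs hbs hvol',
    cap_subset_of_mem_inter hd hK hc hw haw hai hs has (hbig i)⟩

/-- The chain runs from the cap of `i` through a separating cap, the cap of the common cell `k` and
a second separating cap to the cap of `j`. Each of the four links costs one factor `l`. -/
theorem bigCap_subset_of_adj (hd : 0 < d) (hK : IsCompact P) (hc : Convex ℝ P) (hT : 0 < T d η)
    (hs : 0 < s d η) {R : CellSystem P η Q} {i j : Fin Q.m} (h : R.graph.Adj i j) :
    Q.bigCap (gam d) j ⊆ cap P (Q.normal i)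
      (linkFactor d (chainFactor d * T d η) (s d η) ^ 4 * (gam d * (6 * Q.depth i))) := by
  obtain ⟨-, k, hk⟩ := h
  have hA := mul_nonneg (chainFactor_nonneg hd) hT.le
  set l := linkFactor d (chainFactor d * T d η) (s d η) with hl
  have hl1 : 1 ≤ l := by
    have : 0 ≤ (2 : ℝ) ^ (d + 2) * (2 ^ d * (chainFactor d * T d η) /
      (s d η / (2 * (d + 1)) ^ d)) := by positivity
    rw [hl, linkFactor]
    linarith
  have hk0 : 0 ≤ gam d * (6 * Q.depth k) := by
    have h1 := depth_nonneg hK (Q.minimal k).2.1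
    have h2 := one_le_six_mul_gam hd
    rw [← mul_assoc]
    positivity
  obtain ⟨w, r, hr, h1, h2, -, -⟩ := (R.sees_of_S'_subset hd hK hc hT
    (hk.trans Set.inter_subset_left)).exists_link hd hK hc hT hs
  obtain ⟨w', r', hr', -, -, h3, h4⟩ := (R.sees_of_S'_subset hd hK hc hT
    (hk.trans Set.inter_subset_right)).exists_link hd hK hc hT hs
  have h := cap_subset_trans hK hc hr' hl1 (cap_subset_trans hK hc hk0 hl1
    (cap_subset_trans hK hc hr hl1 h1 h2) h3) h4
  refine h.trans (le_of_eq ?_)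
  congr 2
  ring

theorem degree_le (hd : 0 < d) (hP : IsPolytope P) (hint : (interior P).Nonempty)
    (hT : 0 < T d η) (hs : 0 < s d η) (R : CellSystem P η Q) {L : ℝ} (hL : 1 ≤ L)
    (hLl : linkFactor d (chainFactor d * T d η) (s d η) ^ (4 * d) * chainFactor d ≤ Real.exp L)
    (i : Fin Q.m) (J : Finset (Fin Q.m)) (hJ : ∀ j ∈ J, R.graph.Adj i j) :
    (J.card : ℝ) ≤ (2 * (4 * (d + 1)) ^ d) * (wetFactor d * 2 ^ d) * (numFlags P * L ^ d) := by
  have hK := hP.isCompact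
  have hc := hP.convex
  have hA := mul_nonneg (chainFactor_nonneg hd) hT.le
  set l := linkFactor d (chainFactor d * T d η) (s d η) with hl
  have hl1 : 1 ≤ l := by
    have : 0 ≤ (2 : ℝ) ^ (d + 2) * (2 ^ d * (chainFactor d * T d η) /
      (s d η / (2 * (d + 1)) ^ d)) := by positivity
    rw [hl, linkFactor]
    linarith
  set D := cap P (Q.normal i) (l ^ 4 * (gam d * (6 * Q.depth i))) with hD
  have hDvol : volume.real D ≤ l ^ (4 * d) * (chainFactor d * T d η) := by
    refine (volume_cap_mul_le hK hc _ (one_le_pow₀ hl1)).trans ?_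
    rw [← pow_mul]
    gcongr
    refine (Q.volume_bigCap_le hd hK hc hT i).trans ?_
    unfold chainFactor
    have : 0 ≤ (2 : ℝ) ^ (d + 1) * (d * 6 ^ d) * T d η := by positivity
    linarith
  have hwet := volume_cap_inter_wetPart_le hd hP hint (u := Q.normal i)
    (t := l ^ 4 * (gam d * (6 * Q.depth i))) (τ := 2 ^ d * T d η) (L := L) (by positivity) hL (by
      calc (2 : ℝ) ^ d * volume.real D ≤ 2 ^ d * (l ^ (4 * d) * (chainFactor d * T d η)) := by
            gcongr
        _ = 2 ^ d * T d η * (l ^ (4 * d) * chainFactor d) := by ring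
        _ ≤ 2 ^ d * T d η * Real.exp L := by gcongr)
  have hcard := Q.card_mul_le_volume hd hK hc hT J (A := D ∩ wetPart P (2 ^ d * T d η))
    ((measure_mono Set.inter_subset_left).trans_lt (isCompact_cap hK _ _).measure_lt_top).ne
    (fun j hj => Set.subset_inter ((Q.smallCap_subset_bigCap hd hK j).trans
      (bigCap_subset_of_adj hd hK hc hT hs (hJ j hj))) (Q.smallCap_subset_wetPart hd hK hc hT j))
  refine le_of_mul_le_mul_right ?_ hT
  calc (J.card : ℝ) * T d η ≤ _ := hcard
    _ ≤ (2 * (4 * (d + 1)) ^ d) * (numFlags P * (wetFactor d * (2 ^ d * T d η * L ^ d))) := by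
        gcongr
    _ = _ := by ring

end CellSystem

/-- `T/s = α ln ln η (ln η)^β`, so the enlargement factor is polylogarithmic and its logarithm is
`O(ln ln η)`. The threshold `exp (exp 1)` ensures `ln ln η ≥ 1`. -/
theorem exists_linkFactor_bound (hd : 0 < d) :
    ∃ C : ℝ, 1 ≤ C ∧ ∀ η : ℝ, Real.exp (Real.exp 1) ≤ η →
      0 < T d η ∧ 0 < s d η ∧ 1 ≤ Real.log (Real.log η) ∧
      linkFactor d (chainFactor d * T d η) (s d η) ^ (4 * d) * chainFactor d ≤
        Real.exp (C * Real.log (Real.log η)) := by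
  have hd1 : (1 : ℝ) ≤ d := by exact_mod_cast hd
  have hα : 0 < alpha d := by
    unfold alpha
    have : (0 : ℝ) < 4 * d ^ 2 + d - 1 := by nlinarith
    positivity
  have hβ : 0 ≤ beta d := by unfold beta; nlinarith
  have hA := chainFactor_nonneg hd
  set c : ℝ := 2 ^ (d + 2) * (2 ^ d * chainFactor d * alpha d * (2 * (d + 1)) ^ d) with hc
  have hc0 : 0 ≤ c := by positivity
  set M : ℝ := (1 + c) ^ (4 * d) * chainFactor d with hM
  have hM0 : 0 ≤ M := by positivity
  -- The summand `1 + M` absorbs the constant factor, using `M ≤ exp((1 + M)ℓ)` for `ℓ ≥ 1`; the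
  -- rest is the exponent of `ln η`.
  refine ⟨1 + M + (beta d + 1) * (4 * d : ℕ), ?_, fun η hη => ?_⟩
  · have : 0 ≤ (beta d + 1) * (4 * d : ℕ) := by positivity
    linarith
  have hη0 : 0 < η := (Real.exp_pos _).trans_le hη
  have hlog : Real.exp 1 ≤ Real.log η := (Real.le_log_iff_exp_le hη0).2 hη
  have hlog0 : 0 < Real.log η := (Real.exp_pos _).trans_le hlog
  have hℓ : 1 ≤ Real.log (Real.log η) := (Real.le_log_iff_exp_le hlog0).2 hlog
  set ℓ := Real.log (Real.log η) with hℓdef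
  have hℓ0 : 0 < ℓ := by linarith
  have hpow : Real.log η ^ beta d = Real.exp (ℓ * beta d) := by
    rw [Real.exp_mul, hℓdef, Real.exp_log hlog0]
  have hT : 0 < T d η := by unfold T; rw [← hℓdef]; positivity
  have hs : 0 < s d η := by unfold s; positivity
  refine ⟨hT, hs, hℓ, ?_⟩
  have hlink : linkFactor d (chainFactor d * T d η) (s d η) ≤
      (1 + c) * Real.exp ((beta d + 1) * ℓ) := by
    have h1 : linkFactor d (chainFactor d * T d η) (s d η) =
        1 + c * (ℓ * Real.exp (ℓ * beta d)) := by
      rw [linkFactor, T, s, ← hℓdef, hpow, hc]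
      have := Real.exp_pos (ℓ * beta d)
      field_simp
    have h2 : ℓ * Real.exp (ℓ * beta d) ≤ Real.exp ((beta d + 1) * ℓ) := by
      rw [show (beta d + 1) * ℓ = ℓ + ℓ * beta d by ring, Real.exp_add]
      gcongr
      linarith [Real.add_one_le_exp ℓ]
    have h3 : 1 ≤ Real.exp ((beta d + 1) * ℓ) := Real.one_le_exp (by positivity)
    rw [h1, add_mul, one_mul]
    gcongr
  have hlink0 : 0 ≤ linkFactor d (chainFactor d * T d η) (s d η) := by
    unfold linkFactor; positivity
  calc linkFactor d (chainFactor d * T d η) (s d η) ^ (4 * d) * chainFactor d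
      ≤ ((1 + c) * Real.exp ((beta d + 1) * ℓ)) ^ (4 * d) * chainFactor d := by gcongr
    _ = M * Real.exp ((beta d + 1) * (4 * d : ℕ) * ℓ) := by
        rw [mul_pow, ← Real.exp_nat_mul, hM]
        ring_nf
    _ ≤ Real.exp ((1 + M) * ℓ) * Real.exp ((beta d + 1) * (4 * d : ℕ) * ℓ) := by
        gcongr
        have h1 := Real.add_one_le_exp ((1 + M) * ℓ)
        nlinarith
    _ = _ := by rw [← Real.exp_add]; ring_nf

end PoissonPolytope

theorem mainTheorem2 (d : ℕ) (hd : 2 ≤ d) :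
    ∃ c : ℝ, 0 < c ∧ ∃ η₀ : ℝ, ∀ (P : Set (PoissonPolytope.E d)),
      PoissonPolytope.IsPolytope P → MeasureTheory.volume P = 1 →
      ∀ η : ℝ, η₀ ≤ η →
      ∀ (Q : PoissonPolytope.CapSystem P (PoissonPolytope.T d η))
        (R : PoissonPolytope.CellSystem P η Q),
        (R.maxDeg : ℝ) < c * ((PoissonPolytope.numFlags P : ℝ) ^ 6 *
          Real.log (Real.log η) ^ (6 * (d - 1))) := by
  classical
  have hd0 : 0 < d := by omega
  obtain ⟨C, hC, hlink⟩ := PoissonPolytope.exists_linkFactor_bound hd0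
  set B : ℝ := (2 * (4 * (d + 1)) ^ d) * (PoissonPolytope.wetFactor d * 2 ^ d) * C ^ d with hB
  have hB0 : 0 ≤ B := by
    have := PoissonPolytope.wetFactor_nonneg d
    positivity
  refine ⟨B + 1, by linarith, Real.exp (Real.exp 1), fun P hP hvol η hη Q R => ?_⟩
  obtain ⟨hT, hs, hℓ, hL⟩ := hlink η hη
  set ℓ := Real.log (Real.log η) with hℓdef
  have hint : (interior P).Nonempty :=
    PoissonPolytope.interior_nonempty_of_volume_real_pos hP.convex (by
      simp [MeasureTheory.Measure.real, hvol])
  have hF : (1 : ℝ) ≤ PoissonPolytope.numFlags P := by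
    exact_mod_cast PoissonPolytope.one_le_numFlags hP hint
  set F : ℝ := (PoissonPolytope.numFlags P : ℝ) with hFdef
  have hX : 1 ≤ F ^ 6 * ℓ ^ (6 * (d - 1)) :=
    one_le_mul_of_one_le_of_one_le (one_le_pow₀ hF) (one_le_pow₀ hℓ)
  -- The true bound is weakened to the stated one here; `d ≤ 6(d - 1)` needs `d ≥ 2`.
  have hXle : F * ℓ ^ d ≤ F ^ 6 * ℓ ^ (6 * (d - 1)) := by
    have h1 : F ≤ F ^ 6 := le_self_pow₀ hF (by norm_num)
    have h2 : ℓ ^ d ≤ ℓ ^ (6 * (d - 1)) := pow_le_pow_right₀ hℓ (by omega)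
    gcongr
  have hdeg : ∀ i, R.graph.degree i ≤ ⌊B * (F ^ 6 * ℓ ^ (6 * (d - 1)))⌋₊ := fun i => by
    refine Nat.le_floor ?_
    have h1 := R.degree_le hd0 hP hint hT hs
      (L := C * ℓ) (one_le_mul_of_one_le_of_one_le hC hℓ) hL i (R.graph.neighborFinset i)
      fun j hj => (R.graph.mem_neighborFinset i j).1 hj
    calc (R.graph.degree i : ℝ) ≤ _ := h1
      _ = B * (F * ℓ ^ d) := by rw [hB, mul_pow]; ring
      _ ≤ _ := by gcongr
  have hmax : R.maxDeg ≤ ⌊B * (F ^ 6 * ℓ ^ (6 * (d - 1)))⌋₊ := by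
    unfold PoissonPolytope.CellSystem.maxDeg
    refine SimpleGraph.maxDegree_le_of_forall_degree_le _ _ fun i => ?_
    convert hdeg i
  calc (R.maxDeg : ℝ) ≤ (⌊B * (F ^ 6 * ℓ ^ (6 * (d - 1)))⌋₊ : ℝ) := by exact_mod_cast hmax
    _ ≤ B * (F ^ 6 * ℓ ^ (6 * (d - 1))) := Nat.floor_le (by positivity)
    _ < (B + 1) * (F ^ 6 * ℓ ^ (6 * (d - 1))) := by linarith
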